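/- All structures are nonempty. For $n\ge 1$ let $\sigma_n$ be the finite relational vocabulary with binary symbols $\le$, $S_i$, $R_i$ $(1\le i\le n)$ and unary symbols $P_i$ $(2\le i\le n)$; write $x<y$ for $x\le y\wedge x\ne y$. A $\Sigma_m$ (resp. $\Pi_m$) formula is a prenex formula whose quantifier prefix has at most $m$ blocks, the first block being existential (resp. universal); blocks may be empty. For a sentence $\psi$, $\psi^{[x,y]}$ denotes $x\le y\wedge\psi^\star$, where $\psi^\star$ is obtained from $\psi$ by relativizing all quantifiers to $\{z: x\le z\wedge z\le y\}$. Let $\mathrm{NLO}$ be the sentence saying that $\le$ is not a (reflexive, total) linear order. Define $$\mathrm{PartialSucc}_1:=\forall x\forall y\,\bigl(S_1(x,y)\to x<y\wedge\forall z(z\le x\vee y\le z)\bigr),$$ $$\mathrm{Total}_1(x,y):=x<y\wedge\forall z\bigl(x\le z\wedge z<y\to\exists w(z<w\wedge w\le y\wedge S_1(z,w))\bigr),$$ and, for $i\ge2$, $$\mathrm{Succ}_i(x,y):=P_i(x)\wedge P_i(y)\wedge S_i(x,y)\wedge\mathrm{SomeTotalR}_{i-1}^{[x,y]},$$ $$\mathrm{PartialSucc}_i:=\forall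 x\forall y\,\bigl(\mathrm{Succ}_i(x,y)\to\forall z(P_i(z)\to z\le x\vee y\le z)\bigr),$$ $$\mathrm{Total}_i(x,y):=P_i(x)\wedge x<y\wedge\forall z\bigl(P_i(z)\wedge x\le z\wedge z<y\to\exists w(z<w\wedge w\le y\wedge\mathrm{Succ}_i(z,w))\bigr),$$ and, for all $i\ge1$, $$\mathrm{SomeTotalR}_i:=\neg\mathrm{PartialSucc}_i\vee\exists x\exists y\,\bigl(R_i(x,y)\wedge\mathrm{Total}_i(x,y)\bigr).$$ **Theorem.** For every $n\ge1$ there is a $\Sigma_{2n+1}$ sentence $\varphi$ over $\sigma_n$, logically equivalent to $\mathrm{NLO}\vee\mathrm{SomeTotalR}_n$, such that: 1. the finite models of $\varphi$ are closed under extensions (if $A$ is an induced substructure of a finite structure $B$ and $A\models\varphi$, then $B\models\varphi$); 2. on finite structures $\varphi$ is equivalent to a $\mathrm{Datalog}(\neg)$ program (finitely many rules with least-fixed-point semantics and a $0$-ary goal predicate, where in rule bodies relations of $\sigma_n$ and equalities may be negated, but the intensional predicates may not), and also to a sentence of existential transitive-closure logic (built from atoms and negated atoms by $\wedge$, $\vee$,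 $\exists$ and the operator forming the transitive closure of a definable binary relation on $k$-tuples, with parameters allowed); 3. $\varphi$ is not equivalent over finite structures to any $\Pi_{2n+1}$ sentence over $\sigma_n$. Consequently, for every $m$ there are an $n\ge 1$ and a first-order sentence over $\sigma_n$ whose finite models are closed under extensions, which is equivalent on finite structures to a $\mathrm{Datalog}(\neg)$ program and to an existential transitive-closure sentence, but which is not equivalent over finite structures to any $\Sigma_m$ or $\Pi_m$ sentence over $\sigma_n$. -/

import Mathlib

open FirstOrder FirstOrder.Language

/-! ### Prefix classes -/

/-- `PrefixClass b m φ`: the formula `φ` is in prenex normal form, and its quantifier prefix has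
at most `m` blocks, the outermost one being existential for `b = true` and universal for
`b = false` (a block may be empty, so that the classes at level `m` are contained in both classes
at level `m + 1`). -/
inductive PrefixClass {L : Language} {α : Type} :
    Bool → ℕ → ∀ {k : ℕ}, L.BoundedFormula α k → Prop
  | qf {b : Bool} {m k : ℕ} {φ : L.BoundedFormula α k} (h : φ.IsQF) : PrefixClass b m φ
  | ex {m k : ℕ} {φ : L.BoundedFormula α (k + 1)} (h : PrefixClass true (m + 1) φ) :
      PrefixClass true (m + 1) φ.ex
  | all {m k : ℕ} {φ : L.BoundedFormula α (k + 1)} (h : PrefixClass false (m + 1) φ) :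
      PrefixClass false (m + 1) φ.all
  | alternate {b : Bool} {m k : ℕ} {φ : L.BoundedFormula α k} (h : PrefixClass (!b) m φ) :
      PrefixClass b (m + 1) φ

/-- `φ` is a `Σ_m` sentence. -/
def IsSigma {L : Language} (m : ℕ) (φ : L.Sentence) : Prop :=
  PrefixClass true m φ

/-- `φ` is a `Π_m` sentence. -/
def IsPi {L : Language} (m : ℕ) (φ : L.Sentence) : Prop :=
  PrefixClass false m φ

/-- `φ` and `ψ` have the same finite (nonempty) models. -/
def FinEquiv {L : Language} (φ ψ : L.Sentence) : Prop :=
  ∀ (A : Type) [L.Structure A] [Nonempty A] [Finite A], A ⊨ φ ↔ A ⊨ ψ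

/-- The finite models of `φ` are closed under extensions. -/
def ExtensionClosed {L : Language} (φ : L.Sentence) : Prop :=
  ∀ (A B : Type) [L.Structure A] [L.Structure B] [Nonempty A] [Finite A] [Finite B],
    (A ↪[L] B) → A ⊨ φ → B ⊨ φ

/-! ### Datalog with negation, over a relational vocabulary -/

/-- The literals allowed in the body of a rule, with intensional predicates `ι` of the given
arities. Variables are natural numbers. Extensional atoms and equalities may be negated,
intensional atoms may not. -/
inductive DatalogLit (L : Language) (ι : Type) (arity : ι → ℕ) : Type
  | edb {k : ℕ} (r : L.Relations k) (v : Fin k → ℕ)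
  | negEdb {k : ℕ} (r : L.Relations k) (v : Fin k → ℕ)
  | eq (x y : ℕ)
  | neq (x y : ℕ)
  | idb (i : ι) (v : Fin (arity i) → ℕ)

/-- A rule `T₀ ← T₁, …, Tₘ`; the head `T₀` is the intensional atom `head (headVars)`. -/
structure DatalogRule (L : Language) (ι : Type) (arity : ι → ℕ) : Type where
  head : ι
  headVars : Fin (arity head) → ℕ
  body : List (DatalogLit L ι arity)

/-- A Boolean `Datalog(¬)` program: finitely many intensional predicates, finitely many rules and
a `0`-ary goal predicate. -/
structure DatalogProgram (L : Language) : Type 1 where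
  Idb : Type
  finite_idb : Finite Idb
  arity : Idb → ℕ
  rules : List (DatalogRule L Idb arity)
  goal : Idb
  arity_goal : arity goal = 0

/-- Truth of a body literal under the interpretation `I` of the intensional predicates and the
assignment `s` of the variables. -/
def DatalogLit.Holds {L : Language} {ι : Type} {arity : ι → ℕ} {A : Type} [L.Structure A]
    (I : ∀ i : ι, (Fin (arity i) → A) → Prop) (s : ℕ → A) : DatalogLit L ι arity → Prop
  | .edb r v => Structure.RelMap r (s ∘ v)
  | .negEdb r v => ¬ Structure.RelMap r (s ∘ v)
  | .eq x y => s x = s y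
  | .neq x y => s x ≠ s y
  | .idb i v => I i (s ∘ v)

/-- The expansion of `A` by `I` satisfies all the rules of the program. -/
def DatalogProgram.Satisfies {L : Language} (π : DatalogProgram L) (A : Type) [L.Structure A]
    (I : ∀ i : π.Idb, (Fin (π.arity i) → A) → Prop) : Prop :=
  ∀ ρ ∈ π.rules, ∀ s : ℕ → A, (∀ l ∈ ρ.body, l.Holds I s) → I ρ.head (s ∘ ρ.headVars)

/-- The interpretation of the program in `A`: the pointwise smallest expansion that satisfies all
the rules, obtained as the intersection of all of them. -/
def DatalogProgram.interp {L : Language} (π : DatalogProgram L) (A : Type) [L.Structure A] :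
    ∀ i : π.Idb, (Fin (π.arity i) → A) → Prop :=
  fun i a => ∀ I : ∀ i : π.Idb, (Fin (π.arity i) → A) → Prop, π.Satisfies A I → I i a

theorem DatalogLit.Holds.mono {L : Language} {ι : Type} {arity : ι → ℕ} {A : Type}
    [L.Structure A] {I J : ∀ i : ι, (Fin (arity i) → A) → Prop} (hIJ : ∀ i a, I i a → J i a)
    {s : ℕ → A} {l : DatalogLit L ι arity} (h : l.Holds I s) : l.Holds J s := by
  cases l with
  | idb i v => exact hIJ _ _ h
  | _ => exact h

/-- The interpretation is indeed the smallest expansion that satisfies all the rules. -/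
theorem DatalogProgram.isLeast_interp {L : Language} (π : DatalogProgram L) (A : Type)
    [L.Structure A] : IsLeast {I | π.Satisfies A I} (π.interp A) := by
  refine ⟨?_, fun I hI i a h => h I hI⟩
  intro ρ hρ s hs I hI
  exact hI ρ hρ s fun l hl => (hs l hl).mono fun i a h => h I hI

/-- The Boolean query computed by the program: its `0`-ary goal predicate is true. -/
def DatalogProgram.Accepts {L : Language} (π : DatalogProgram L) (A : Type) [L.Structure A] :
    Prop :=
  π.interp A π.goal fun j => (Fin.cast π.arity_goal j).elim0

/-- `φ` is equivalent on finite structures to a `Datalog(¬)` program. -/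
def DatalogDefinable {L : Language} (φ : L.Sentence) : Prop :=
  ∃ π : DatalogProgram L, ∀ (A : Type) [L.Structure A] [Nonempty A] [Finite A],
    A ⊨ φ ↔ π.Accepts A

/-! ### Existential transitive-closure logic, over a relational vocabulary -/

/-- Formulas of the existential fragment of transitive-closure logic with free variables
`0, …, m - 1`: built from atoms and negated atoms by conjunction, disjunction, existential
quantification and (positive) transitive closure. In `tc φ u v`, the formula `φ` has, besides the
parameters `0, …, m - 1`, the two `k`-tuples of bound variables `m, …, m + k - 1` and
`m + k, …, m + 2 k - 1`. -/
inductive ETCFormula (L : Language) : ℕ → Type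
  | rel {m k : ℕ} (r : L.Relations k) (v : Fin k → Fin m) : ETCFormula L m
  | negRel {m k : ℕ} (r : L.Relations k) (v : Fin k → Fin m) : ETCFormula L m
  | eq {m : ℕ} (x y : Fin m) : ETCFormula L m
  | neq {m : ℕ} (x y : Fin m) : ETCFormula L m
  | and {m : ℕ} (φ ψ : ETCFormula L m) : ETCFormula L m
  | or {m : ℕ} (φ ψ : ETCFormula L m) : ETCFormula L m
  | ex {m : ℕ} (φ : ETCFormula L (m + 1)) : ETCFormula L m
  | tc {m k : ℕ} (φ : ETCFormula L (m + k + k)) (u v : Fin k → Fin m) : ETCFormula L m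

/-- The semantics of existential transitive-closure logic. -/
def ETCFormula.Realize {L : Language} {A : Type} [L.Structure A] :
    ∀ {m : ℕ}, ETCFormula L m → (Fin m → A) → Prop
  | _, .rel r v, s => Structure.RelMap r (s ∘ v)
  | _, .negRel r v, s => ¬ Structure.RelMap r (s ∘ v)
  | _, .eq x y, s => s x = s y
  | _, .neq x y, s => s x ≠ s y
  | _, .and φ ψ, s => φ.Realize s ∧ ψ.Realize s
  | _, .or φ ψ, s => φ.Realize s ∨ ψ.Realize s
  | _, .ex φ, s => ∃ a : A, φ.Realize (Fin.snoc s a)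
  | _, .tc φ u v, s =>
      Relation.TransGen (fun a b => φ.Realize (Fin.append (Fin.append s a) b)) (s ∘ u) (s ∘ v)

/-- `φ` is equivalent on finite structures to an existential transitive-closure sentence. -/
def ETCDefinable {L : Language} (φ : L.Sentence) : Prop :=
  ∃ τ : ETCFormula L 0, ∀ (A : Type) [L.Structure A] [Nonempty A] [Finite A],
    A ⊨ φ ↔ τ.Realize (Fin.elim0 : Fin 0 → A)

/-! ### The vocabularies and the sentences -/

/-- The relation symbols of the vocabulary `σ_n`: the binary symbols `≤`, `S_i`, `R_i` for
`1 ≤ i ≤ n` (where `S_1 = S` and `R_1 = R`) and the unary symbols `P_i` for `2 ≤ i ≤ n`. -/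
inductive SigmaRel (n : ℕ) : ℕ → Type
  | le : SigmaRel n 2
  | S (i : ℕ) (h : 1 ≤ i ∧ i ≤ n) : SigmaRel n 2
  | R (i : ℕ) (h : 1 ≤ i ∧ i ≤ n) : SigmaRel n 2
  | P (i : ℕ) (h : 2 ≤ i ∧ i ≤ n) : SigmaRel n 1

/-- The vocabulary `σ_n`. -/
def sigmaLang (n : ℕ) : Language :=
  ⟨fun _ => Empty, SigmaRel n⟩

/-- The symbol `≤` of `σ_n`. -/
def leSym (n : ℕ) : (sigmaLang n).Relations 2 := SigmaRel.le

/-- The symbol `S_i` of `σ_n`. -/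
def sSymb (n i : ℕ) (h : 1 ≤ i ∧ i ≤ n) : (sigmaLang n).Relations 2 := SigmaRel.S i h

/-- The symbol `R_i` of `σ_n`. -/
def rSymb (n i : ℕ) (h : 1 ≤ i ∧ i ≤ n) : (sigmaLang n).Relations 2 := SigmaRel.R i h

/-- The symbol `P_i` of `σ_n`. -/
def pSymb (n i : ℕ) (h : 2 ≤ i ∧ i ≤ n) : (sigmaLang n).Relations 1 := SigmaRel.P i h

/-- The formula `s ≤ t`. -/
def leF {n k : ℕ} {α : Type} (s t : (sigmaLang n).Term (α ⊕ Fin k)) :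
    (sigmaLang n).BoundedFormula α k :=
  (leSym n).boundedFormula₂ s t

/-- The formula `s < t`, that is, `s ≤ t ∧ s ≠ t`. -/
def ltF {n k : ℕ} {α : Type} (s t : (sigmaLang n).Term (α ⊕ Fin k)) :
    (sigmaLang n).BoundedFormula α k :=
  leF s t ⊓ ∼(s =' t)

/-- The sentence `NLO`: `≤` is not a linear order. -/
def NLO (n : ℕ) : (sigmaLang n).Sentence :=
  ∼((leSym n).reflexive ⊓ (leSym n).antisymmetric ⊓ (leSym n).transitive ⊓ (leSym n).total)

/-- The relativization `φ^⋆` of all quantifiers to the interval `[x, y]`, where `x` and `y` are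
the free variables `0` and `1`. As `∃` is `¬ ∀ ¬`, it turns `∃ z, θ` into a formula equivalent to
`∃ z, (x ≤ z ∧ z ≤ y) ∧ θ^⋆`. -/
def relativizeStar {n : ℕ} :
    ∀ {k : ℕ}, (sigmaLang n).BoundedFormula Empty k → (sigmaLang n).BoundedFormula (Fin 2) k
  | _, .falsum => .falsum
  | _, .equal s t => .equal (s.relabel (Sum.map Empty.elim id)) (t.relabel (Sum.map Empty.elim id))
  | _, .rel r ts => .rel r fun j => (ts j).relabel (Sum.map Empty.elim id)
  | _, .imp φ ψ => .imp (relativizeStar φ) (relativizeStar ψ)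
  | k, .all φ =>
      .all ((leF (Term.var (Sum.inl 0)) (&(Fin.last k)) ⊓
        leF (&(Fin.last k)) (Term.var (Sum.inl 1))) ⟹ relativizeStar φ)

/-- The formula `φ^{[x, y]}`, that is, `x ≤ y ∧ φ^⋆`, for a sentence `φ`. -/
def relativize {n : ℕ} (φ : (sigmaLang n).Sentence) : (sigmaLang n).Formula (Fin 2) :=
  leF (Term.var (Sum.inl 0)) (Term.var (Sum.inl 1)) ⊓ relativizeStar φ

/-- The formula `φ(x, y)` for two bound variables `x` and `y`. -/
def applyVars {n k : ℕ} (φ : (sigmaLang n).Formula (Fin 2)) (x y : Fin k) :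
    (sigmaLang n).BoundedFormula Empty k :=
  BoundedFormula.relabel (fun j => (Sum.inr (![x, y] j) : Empty ⊕ Fin k)) φ

/-- `PartialSucc`: whenever `S(x, y)`, the element `y` is the successor of `x`. -/
def partialSuccOne (n : ℕ) (h : 1 ≤ 1 ∧ 1 ≤ n) : (sigmaLang n).Sentence :=
  ∀' ∀' ((sSymb n 1 h).boundedFormula₂ &0 &1 ⟹
    (ltF &0 &1 ⊓ ∀' (leF &2 &0 ⊔ leF &1 &2)))

/-- `Total(x, y)`, where `x` and `y` are the variables `0` and `1`. -/
def totalOne (n : ℕ) (h : 1 ≤ 1 ∧ 1 ≤ n) : (sigmaLang n).BoundedFormula Empty 2 :=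
  ltF &0 &1 ⊓ ∀' ((leF &0 &2 ⊓ ltF &2 &1) ⟹
    ∃' (ltF &2 &3 ⊓ leF &3 &1 ⊓ (sSymb n 1 h).boundedFormula₂ &2 &3))

/-- `Succ_i(x, y)`, for `i ≥ 2`, where `ψ` is the sentence `SomeTotalR_{i-1}`. -/
def succF (n i : ℕ) (h : 2 ≤ i ∧ i ≤ n) (ψ : (sigmaLang n).Sentence) :
    (sigmaLang n).Formula (Fin 2) :=
  (pSymb n i h).formula₁ (Term.var 0) ⊓ (pSymb n i h).formula₁ (Term.var 1) ⊓
    (sSymb n i ⟨by omega, h.2⟩).formula₂ (Term.var 0) (Term.var 1) ⊓ relativize ψ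

/-- `PartialSucc_i`, for `i ≥ 2`, where `ψ` is the sentence `SomeTotalR_{i-1}`. -/
def partialSucc (n i : ℕ) (h : 2 ≤ i ∧ i ≤ n) (ψ : (sigmaLang n).Sentence) :
    (sigmaLang n).Sentence :=
  ∀' ∀' (applyVars (succF n i h ψ) 0 1 ⟹
    ∀' ((pSymb n i h).boundedFormula₁ &2 ⟹ (leF &2 &0 ⊔ leF &1 &2)))

/-- `Total_i(x, y)`, for `i ≥ 2`, where `ψ` is the sentence `SomeTotalR_{i-1}` and `x`, `y` are
the variables `0` and `1`. The left endpoint is required to be in `P_i`: otherwise the formula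
would hold vacuously in intervals that contain no element of `P_i`. -/
def totalF (n i : ℕ) (h : 2 ≤ i ∧ i ≤ n) (ψ : (sigmaLang n).Sentence) :
    (sigmaLang n).BoundedFormula Empty 2 :=
  (pSymb n i h).boundedFormula₁ &0 ⊓ ltF &0 &1 ⊓
    ∀' (((pSymb n i h).boundedFormula₁ &2 ⊓ leF &0 &2 ⊓ ltF &2 &1) ⟹
      ∃' (ltF &2 &3 ⊓ leF &3 &1 ⊓ applyVars (succF n i h ψ) 2 3))

/-- `SomeTotalR_i`, for `1 ≤ i ≤ n`, as a `σ_n`-sentence. -/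
def someTotalRAux (n : ℕ) : (i : ℕ) → 1 ≤ i → i ≤ n → (sigmaLang n).Sentence
  | 0, h, _ => absurd h (by omega)
  | 1, h, h' =>
      ∼(partialSuccOne n ⟨h, h'⟩) ⊔
        ∃' ∃' ((rSymb n 1 ⟨h, h'⟩).boundedFormula₂ &0 &1 ⊓ totalOne n ⟨h, h'⟩)
  | i + 2, h, h' =>
      ∼(partialSucc n (i + 2) ⟨by omega, h'⟩
          (someTotalRAux n (i + 1) (by omega) (by omega))) ⊔
        ∃' ∃' ((rSymb n (i + 2) ⟨h, h'⟩).boundedFormula₂ &0 &1 ⊓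
          totalF n (i + 2) ⟨by omega, h'⟩
            (someTotalRAux n (i + 1) (by omega) (by omega)))

/-- The sentence `SomeTotalR_n`. -/
def someTotalR (n : ℕ) (hn : 1 ≤ n) : (sigmaLang n).Sentence :=
  someTotalRAux n n hn le_rfl

/-!
The sentence `φ` is a prenex form of `NLO ∨ SomeTotalR_n`. Its prefix is read off the recursion
(`prefixDefinable_someTotal`): the quantifiers `∀ z ∃ w` of `Total_i` add two blocks to those of
`SomeTotalR_{i-1}`.

For the upper bounds, replace `Total_i(x, y)` by "an ascending path of `Succ_i`-steps leads from `x`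
to `y`". Over a finite linear order this does not change `SomeTotalR_i`: totality yields a path, and
a path that is not total passes over an element of `P_i`, so that `PartialSucc_i` fails and
`SomeTotalR_i` holds anyway (`Dat.IsLO.someTotal_iff`). The path variant is positive in all symbols
but `≤`, hence preserved under embeddings (`Dat.Emb.map_path`), and it is visibly expressible with
transitive closures (`ETCFormula.realize_notLinear_or`) and by a Datalog program
(`SomeTotalIdb.accepts_iff`).

For the lower bound, it suffices to find, for every `k`, finite linear orders `A ⊨ SomeTotalR_n` and
`B ⊭ SomeTotalR_n` such that Duplicator wins the game with `2 n + 1` rounds of `k` picks in which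
Spoiler starts in `B` and changes sides after every round; then a `Π_{2n+1}` sentence with few
quantifiers that holds in `A` holds in `B` (`Marked.exists_transfer`). Call this `B ≼ A`. The
structures are words over an alphabet of smaller structures, and the game is compatible with
concatenation. The engine is `Marked.exists_round_insert`: if `X ≼ Y` in `m` rounds, then
`Y^K ≼ Y^K X Y^K` in `m + 1` rounds for large `K`, because Duplicator can place `X` far from the
first picks of Spoiler and afterwards treat it as one more `Y`. Given `B ≼ A` for `SomeTotalR_i` in
`2 i + 1` rounds, put a point of `P_{i+1}` in front of them to obtain `X` (from `B`) and `Y` (from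
`A`). A power of `Y` has its consecutive points joined by `Succ_{i+1}`, so it becomes a total interval
`T` when `R_{i+1}` joins its ends, whereas `Y^K X Y^K` becomes an interval `G` with a gap, and
`T ≼ G` in `2 i + 2` rounds. A second insertion gives `G^K ≼ G^K T G^K` in `2 i + 3` rounds; the left
side has no total interval and the right side has one (`Marked.LevelPair.exists_finalPair`). The
induction starts with an empty structure and a point, which cannot be told apart by picks in the
empty structure.
-/

/-! ### The semantics of `SomeTotalR_i` and its monotone variant -/

/-- The interpretation of the symbols `≤`, `S_i`, `R_i`, `P_i` on a set, for all indices at once. -/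
structure Dat (A : Type) where
  le : A → A → Prop
  S : ℕ → A → A → Prop
  R : ℕ → A → A → Prop
  P : ℕ → A → Prop

namespace Dat

variable {A B : Type} (d : Dat A) (e : Dat B)

/-- The strict part of `≤`, as in the sentences: it is the usual one only if `≤` is an order. -/
def lt (x y : A) : Prop := d.le x y ∧ x ≠ y

/-- `P_i`, where `P_1` is the whole universe, so that level `1` follows the pattern of the other
levels. -/
def pt (i : ℕ) (x : A) : Prop := i = 1 ∨ d.P i x

/-- The interval to which a relativization refers. -/
def Icc (a b : A) : Set A := {z | d.le a z ∧ d.le z b}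

/-- `≤` is a (reflexive, total) linear order. -/
structure IsLO : Prop where
  refl : ∀ x, d.le x x
  antisymm : ∀ x y, d.le x y → d.le y x → x = y
  trans : ∀ x y z, d.le x y → d.le y z → d.le x z
  total : ∀ x y, d.le x y ∨ d.le y x

theorem isLO_iff : d.IsLO ↔ (∀ x, d.le x x) ∧ (∀ x y, d.le x y → d.le y x → x = y) ∧
    (∀ x y z, d.le x y → d.le y z → d.le x z) ∧ ∀ x y, d.le x y ∨ d.le y x :=
  ⟨fun h => ⟨h.refl, h.antisymm, h.trans, h.total⟩, fun h => ⟨h.1, h.2.1, h.2.2.1, h.2.2.2⟩⟩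

/-- `Succ_i`, where `T` says which intervals satisfy `SomeTotalR_{i-1}`. -/
def succRel (i : ℕ) (T : Set A → Prop) (x y : A) : Prop :=
  d.pt i x ∧ d.pt i y ∧ d.S i x y ∧ d.le x y ∧ T (d.Icc x y)

/-- `Total_i`, for the successor relation `σ`. -/
def total (i : ℕ) (σ : A → A → Prop) (x y : A) : Prop :=
  d.pt i x ∧ d.lt x y ∧ ∀ z, d.pt i z → d.le x z → d.lt z y → ∃ w, d.lt z w ∧ d.le w y ∧ σ z w

/-- The monotone variant of `Total_i`: an ascending path of `σ`-steps leads from `x` to `y`. -/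
def path (_ : ℕ) (σ : A → A → Prop) : A → A → Prop :=
  Relation.TransGen fun u v => σ u v ∧ d.lt u v

/-- `SomeTotalR_i` in the substructure with universe `D`, where `conn` is either `d.total` or its
variant `d.path`. Level `0` holds everywhere, so that `Succ_1` is `S_1` on pairs `x ≤ y`; the
pairs of `S_1` that are not ascending also violate `PartialSucc_1`, whence the first disjunct. -/
def SomeTotal (conn : ℕ → (A → A → Prop) → A → A → Prop) : ℕ → Set A → Prop
  | 0, _ => True
  | i + 1, D =>
      (i = 0 ∧ ∃ x ∈ D, ∃ y ∈ D, d.S 1 x y ∧ ¬ d.lt x y) ∨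
      (∃ x ∈ D, ∃ y ∈ D, d.succRel (i + 1) (SomeTotal conn i) x y ∧
        ∃ z ∈ D, d.pt (i + 1) z ∧ ¬ d.le z x ∧ ¬ d.le y z) ∨
      ∃ x ∈ D, ∃ y ∈ D, d.R (i + 1) x y ∧
        conn (i + 1) (d.succRel (i + 1) (SomeTotal conn i)) x y

theorem someTotal_succ {conn : ℕ → (A → A → Prop) → A → A → Prop} {i : ℕ} {D : Set A} :
    d.SomeTotal conn (i + 1) D ↔
      (i = 0 ∧ ∃ x ∈ D, ∃ y ∈ D, d.S 1 x y ∧ ¬ d.lt x y) ∨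
      (∃ x ∈ D, ∃ y ∈ D, d.succRel (i + 1) (d.SomeTotal conn i) x y ∧
        ∃ z ∈ D, d.pt (i + 1) z ∧ ¬ d.le z x ∧ ¬ d.le y z) ∨
      ∃ x ∈ D, ∃ y ∈ D, d.R (i + 1) x y ∧
        conn (i + 1) (d.succRel (i + 1) (d.SomeTotal conn i)) x y :=
  Iff.rfl

theorem SomeTotal.mono {conn : ℕ → (A → A → Prop) → A → A → Prop} {i : ℕ} {D D' : Set A}
    (h : D ⊆ D') (hT : d.SomeTotal conn i D) : d.SomeTotal conn i D' := by
  cases i with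
  | zero => trivial
  | succ i =>
    rcases hT with ⟨h0, x, hx, y, hy, h1⟩ | ⟨x, hx, y, hy, h1, z, hz, h2⟩ | ⟨x, hx, y, hy, h1⟩
    · exact Or.inl ⟨h0, x, h hx, y, h hy, h1⟩
    · exact Or.inr (Or.inl ⟨x, h hx, y, h hy, h1, z, h hz, h2⟩)
    · exact Or.inr (Or.inr ⟨x, h hx, y, h hy, h1⟩)

variable {d e}

theorem IsLO.not_le (h : d.IsLO) {x y : A} : ¬ d.le x y ↔ d.lt y x := by
  unfold lt
  constructor
  · intro hxy
    rcases h.total x y with h1 | h1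
    · exact absurd h1 hxy
    · exact ⟨h1, fun h2 => hxy (h2 ▸ h.refl _)⟩
  · rintro ⟨h1, h2⟩ h3
    exact h2 (h.antisymm _ _ h1 h3)

theorem IsLO.not_lt (h : d.IsLO) {x y : A} : ¬ d.lt x y ↔ d.le y x := by
  rw [← h.not_le, not_not]

theorem IsLO.lt_of_lt_of_le (h : d.IsLO) {x y z : A} (h1 : d.lt x y) (h2 : d.le y z) :
    d.lt x z := by
  rw [← h.not_le] at *
  exact fun h3 => h1 (h.trans _ _ _ h2 h3)

theorem IsLO.lt_trans (h : d.IsLO) {x y z : A} (h1 : d.lt x y) (h2 : d.lt y z) : d.lt x z :=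
  h.lt_of_lt_of_le h1 h2.1

theorem IsLO.lt_of_path (h : d.IsLO) {i : ℕ} {σ : A → A → Prop} {x y : A}
    (hp : d.path i σ x y) : d.lt x y := by
  induction hp with
  | single h1 => exact h1.2
  | tail _ h1 ih => exact h.lt_trans ih h1.2

theorem IsLO.wf (h : d.IsLO) [Finite A] : WellFounded fun x y : A => d.lt y x := by
  have : IsTrans A fun x y => d.lt y x := ⟨fun _ _ _ h1 h2 => h.lt_trans h2 h1⟩
  have : Std.Irrefl fun x y : A => d.lt y x := ⟨fun _ h1 => h1.2 rfl⟩
  exact Finite.wellFounded_of_trans_of_irrefl _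

/-- Following successors upwards from `x` turns totality into a path, which ends because the order is
finite. -/
theorem IsLO.path_of_total (h : d.IsLO) [Finite A] {i : ℕ} {T : Set A → Prop} {x y : A}
    (ht : d.total i (d.succRel i T) x y) : d.path i (d.succRel i T) x y := by
  obtain ⟨hx, hxy, ht⟩ := ht
  induction x using h.wf.induction with
  | _ x ih =>
    obtain ⟨w, hw, hwy, hs⟩ := ht x hx (h.refl x) hxy
    by_cases hwy' : w = y
    · subst hwy'
      exact .single ⟨hs, hw⟩
    · exact .head ⟨hs, hw⟩ (ih w hw hs.2.1 ⟨hwy, hwy'⟩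
        fun z hz hwz hzy => ht z hz (h.trans _ _ _ hw.1 hwz) hzy)

/-- If no element of `P_i` lies strictly inside a successor pair, then a path visits all the
elements of `P_i` that it could miss. -/
theorem IsLO.total_of_path (h : d.IsLO) {i : ℕ} {T : Set A → Prop} {x y : A}
    (hv : ∀ u v, d.le x u → d.le v y → d.succRel i T u v →
      ∀ z, d.pt i z → d.lt u z → d.lt z v → False)
    (hp : d.path i (d.succRel i T) x y) : d.total i (d.succRel i T) x y := by
  refine ⟨?_, h.lt_of_path hp, ?_⟩
  · obtain ⟨_, h1, _⟩ := Relation.TransGen.head'_iff.1 hp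
    exact h1.1.1
  · intro z hz hxz hzy
    induction hp with
    | @single v h1 =>
      rcases eq_or_ne x z with rfl | hne
      · exact ⟨v, h1.2, h.refl _, h1.1⟩
      · exact (hv x v (h.refl _) (h.refl _) h1.1 z hz ⟨hxz, hne⟩ hzy).elim
    | @tail u v hp h1 ih =>
      by_cases hzu : d.lt z u
      · obtain ⟨w, h2, h3, h4⟩ := ih
          (fun a b ha hb => hv a b ha (h.trans _ _ _ hb h1.2.1)) hzu
        exact ⟨w, h2, h.trans _ _ _ h3 h1.2.1, h4⟩
      · rw [h.not_lt] at hzu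
        rcases eq_or_ne u z with rfl | hne
        · exact ⟨v, h1.2, h.refl _, h1.1⟩
        · exact (hv u v (h.lt_of_path (i := i) hp).1 (h.refl _) h1.1 z hz ⟨hzu, hne⟩ hzy).elim

theorem IsLO.Icc_subset (h : d.IsLO) {a b x y : A} (hx : x ∈ d.Icc a b) (hy : y ∈ d.Icc a b) :
    d.Icc x y ⊆ d.Icc a b :=
  fun _ hz => ⟨h.trans _ _ _ hx.1 hz.1, h.trans _ _ _ hz.2 hy.2⟩

/-- On a convex subset of a finite linear order, totality may be replaced by the existence of a
path, since the two differ only where `PartialSucc_i` fails. -/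
theorem IsLO.someTotal_iff (h : d.IsLO) [Finite A] (i : ℕ) (D : Set A)
    (hD : ∀ x ∈ D, ∀ y ∈ D, d.Icc x y ⊆ D) :
    d.SomeTotal d.total i D ↔ d.SomeTotal d.path i D := by
  induction i generalizing D with
  | zero => rfl
  | succ i ih =>
    have hs : d.succRel (i + 1) (d.SomeTotal d.total i) =
        d.succRel (i + 1) (d.SomeTotal d.path i) := by
      ext x y
      unfold succRel
      rw [ih _ fun _ hx _ hy => h.Icc_subset hx hy]
    unfold SomeTotal
    rw [hs]
    refine or_congr_right ⟨?_, ?_⟩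
    · rintro (h1 | ⟨x, hx, y, hy, hR, ht⟩)
      · exact Or.inl h1
      · exact Or.inr ⟨x, hx, y, hy, hR, h.path_of_total ht⟩
    · rintro (h1 | ⟨x, hx, y, hy, hR, ht⟩)
      · exact Or.inl h1
      · by_cases hv : ∃ x ∈ D, ∃ y ∈ D, d.succRel (i + 1) (d.SomeTotal d.path i) x y ∧
            ∃ z ∈ D, d.pt (i + 1) z ∧ ¬ d.le z x ∧ ¬ d.le y z
        · exact Or.inl hv
        · refine Or.inr ⟨x, hx, y, hy, hR, h.total_of_path ?_ ht⟩
          intro u v hu hv' hsu z hz huz hzv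
          have hmem : ∀ w, d.le x w → d.le w y → w ∈ D := fun w h1 h2 => hD x hx y hy ⟨h1, h2⟩
          have huv : d.le u v := hsu.2.2.2.1
          exact hv ⟨u, hmem u hu (h.trans _ _ _ huv hv'), v, hmem v (h.trans _ _ _ hu huv) hv',
            hsu, z, hmem z (h.trans _ _ _ hu huz.1) (h.trans _ _ _ hzv.1 hv'), hz,
            h.not_le.2 huz, h.not_le.2 hzv⟩

/-- `f` is an embedding with respect to the symbols of levels `1, …, n`. -/
structure Emb (n : ℕ) (d : Dat A) (e : Dat B) (f : A → B) : Prop where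
  inj : Function.Injective f
  le : ∀ x y, e.le (f x) (f y) ↔ d.le x y
  S : ∀ i, 1 ≤ i → i ≤ n → ∀ x y, e.S i (f x) (f y) ↔ d.S i x y
  R : ∀ i, 1 ≤ i → i ≤ n → ∀ x y, e.R i (f x) (f y) ↔ d.R i x y
  pt : ∀ i, 1 ≤ i → i ≤ n → ∀ x, e.pt i (f x) ↔ d.pt i x

theorem Emb.lt {n : ℕ} {f : A → B} (h : Emb n d e f) (x y : A) :
    e.lt (f x) (f y) ↔ d.lt x y := by
  simp only [Dat.lt, h.le, ne_eq, h.inj.eq_iff]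

theorem Emb.preimage_Icc {n : ℕ} {f : A → B} (h : Emb n d e f) (x y : A) :
    f ⁻¹' e.Icc (f x) (f y) = d.Icc x y := by
  ext z
  simp [Dat.Icc, h.le]

/-- The path variant of `SomeTotalR_i` is preserved under embeddings, all its mentions of the symbols
`S_j`, `R_j`, `P_j` being positive. -/
theorem Emb.map_path {n : ℕ} {f : A → B} (h : Emb n d e f) {i : ℕ} (hi : i ≤ n) {D : Set A}
    {D' : Set B} (hD : ∀ x ∈ D, f x ∈ D') (hT : d.SomeTotal d.path i D) :
    e.SomeTotal e.path i D' := by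
  induction i generalizing D D' with
  | zero => trivial
  | succ i ih =>
    have hs : ∀ x y, d.succRel (i + 1) (d.SomeTotal d.path i) x y →
        e.succRel (i + 1) (e.SomeTotal e.path i) (f x) (f y) := by
      rintro x y ⟨h1, h2, h3, h4, h5⟩
      refine ⟨(h.pt _ (by omega) hi _).2 h1, (h.pt _ (by omega) hi _).2 h2,
        (h.S _ (by omega) hi _ _).2 h3, (h.le _ _).2 h4, ih (by omega) ?_ h5⟩
      exact fun z hz => ⟨(h.le _ _).2 hz.1, (h.le _ _).2 hz.2⟩
    rcases hT with ⟨h0, x, hx, y, hy, h1, h2⟩ | ⟨x, hx, y, hy, h1, z, hz, h2, h3, h4⟩ |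
      ⟨x, hx, y, hy, h1, h2⟩
    · exact Or.inl ⟨h0, f x, hD x hx, f y, hD y hy, (h.S _ (by omega) (by omega) _ _).2 h1,
        fun h3 => h2 ((h.lt _ _).1 h3)⟩
    · exact Or.inr (Or.inl ⟨f x, hD x hx, f y, hD y hy, hs _ _ h1, f z, hD z hz,
        (h.pt _ (by omega) hi _).2 h2, fun h5 => h3 ((h.le _ _).1 h5),
        fun h5 => h4 ((h.le _ _).1 h5)⟩)
    · refine Or.inr (Or.inr ⟨f x, hD x hx, f y, hD y hy, (h.R _ (by omega) hi _ _).2 h1, ?_⟩)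
      exact Relation.TransGen.lift f (fun u v huv => ⟨hs _ _ huv.1, (h.lt _ _).2 huv.2⟩) _ _ h2

/-- If the range of an embedding is convex and contains all the pairs of `D` that are related by
`S_j` or `R_j`, `j ≤ i`, then the rest of `D` does not matter for `SomeTotalR_i`. -/
theorem Emb.reflect_path {n : ℕ} {f : A → B} (h : Emb n d e f) (hLO : e.IsLO) {i : ℕ}
    (hi : i ≤ n) (hconv : ∀ x y z, e.le (f x) z → e.le z (f y) → z ∈ Set.range f)
    {D : Set B} (hD : ∀ x ∈ D, ∀ y ∈ D, e.Icc x y ⊆ D)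
    (hR : ∀ j, 1 ≤ j → j ≤ i → ∀ x ∈ D, ∀ y ∈ D, e.S j x y ∨ e.R j x y →
      x ∈ Set.range f ∧ y ∈ Set.range f)
    (hT : e.SomeTotal e.path i D) : d.SomeTotal d.path i (f ⁻¹' D) := by
  induction i generalizing D with
  | zero => trivial
  | succ i ih =>
    have hs : ∀ x y, e.succRel (i + 1) (e.SomeTotal e.path i) (f x) (f y) →
        d.succRel (i + 1) (d.SomeTotal d.path i) x y := by
      rintro x y ⟨h1, h2, h3, h4, h5⟩
      refine ⟨(h.pt _ (by omega) hi _).1 h1, (h.pt _ (by omega) hi _).1 h2,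
        (h.S _ (by omega) hi _ _).1 h3, (h.le _ _).1 h4, ?_⟩
      rw [← h.preimage_Icc]
      refine ih (by omega) (fun _ hx _ hy => hLO.Icc_subset hx hy) ?_ h5
      exact fun j _ _ u hu v hv _ => ⟨hconv x y u hu.1 hu.2, hconv x y v hv.1 hv.2⟩
    rcases hT with ⟨h0, x, hx, y, hy, h1, h2⟩ | ⟨x, hx, y, hy, h1, z, hz, h2, h3, h4⟩ |
      ⟨x, hx, y, hy, h1, h2⟩
    · obtain ⟨⟨x, rfl⟩, ⟨y, rfl⟩⟩ := hR 1 le_rfl (by omega) x hx y hy (Or.inl h1)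
      exact Or.inl ⟨h0, x, hx, y, hy, (h.S _ (by omega) (by omega) _ _).1 h1,
        fun h3 => h2 ((h.lt _ _).2 h3)⟩
    · obtain ⟨⟨x, rfl⟩, ⟨y, rfl⟩⟩ := hR (i + 1) (by omega) le_rfl x hx y hy (Or.inl h1.2.2.1)
      obtain ⟨z, rfl⟩ := hconv x y z (hLO.not_le.1 h3).1 (hLO.not_le.1 h4).1
      exact Or.inr (Or.inl ⟨x, hx, y, hy, hs _ _ h1, z, hz, (h.pt _ (by omega) hi _).1 h2,
        fun h5 => h3 ((h.le _ _).2 h5), fun h5 => h4 ((h.le _ _).2 h5)⟩)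
    · obtain ⟨⟨x, rfl⟩, ⟨y, rfl⟩⟩ := hR (i + 1) (by omega) le_rfl x hx y hy (Or.inr h1)
      refine Or.inr (Or.inr ⟨x, hx, y, hy, (h.R _ (by omega) hi _ _).1 h1, ?_⟩)
      -- All the vertices of the path lie between `f x` and `f y`.
      have key : ∀ v, Relation.TransGen
          (fun u v => e.succRel (i + 1) (e.SomeTotal e.path i) u v ∧ e.lt u v) (f x) v →
          e.le v (f y) → ∃ v', f v' = v ∧ d.path (i + 1)
            (d.succRel (i + 1) (d.SomeTotal d.path i)) x v' := by
        intro v hv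
        induction hv with
        | single h3 =>
          intro hvy
          obtain ⟨v, rfl⟩ := hconv x y _ h3.2.1 hvy
          exact ⟨v, rfl, .single ⟨hs _ _ h3.1, (h.lt _ _).1 h3.2⟩⟩
        | tail h3 h4 ih' =>
          intro hvy
          obtain ⟨u, rfl, hu⟩ := ih' (hLO.trans _ _ _ h4.2.1 hvy)
          obtain ⟨v, rfl⟩ := hconv u y _ h4.2.1 hvy
          exact ⟨v, rfl, .tail hu ⟨hs _ _ h4.1, (h.lt _ _).1 h4.2⟩⟩
      obtain ⟨v', hv', hp⟩ := key _ h2 (hLO.refl _)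
      rwa [h.inj hv'] at hp

/-- `SomeTotalR_i` in a convex substructure. -/
theorem Emb.someTotal_total_iff {n : ℕ} {f : A → B} (h : Emb n d e f)
    (hconv : ∀ x y z, e.le (f x) z → e.le z (f y) → z ∈ Set.range f) {i : ℕ}
    (hi : i ≤ n) {D : Set B} (hD : D ⊆ Set.range f) :
    e.SomeTotal e.total i D ↔ d.SomeTotal d.total i (f ⁻¹' D) := by
  induction i generalizing D with
  | zero => rfl
  | succ i ih =>
    have hs : ∀ x y, e.succRel (i + 1) (e.SomeTotal e.total i) (f x) (f y) ↔
        d.succRel (i + 1) (d.SomeTotal d.total i) x y := by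
      intro x y
      unfold succRel
      rw [h.pt _ (by omega) hi, h.pt _ (by omega) hi, h.S _ (by omega) hi, h.le,
        ih (by omega) fun z hz => hconv x y z hz.1 hz.2, h.preimage_Icc]
    have ht : ∀ x y, e.total (i + 1) (e.succRel (i + 1) (e.SomeTotal e.total i)) (f x) (f y) ↔
        d.total (i + 1) (d.succRel (i + 1) (d.SomeTotal d.total i)) x y := by
      intro x y
      unfold total
      rw [h.pt _ (by omega) hi, h.lt]
      refine and_congr_right fun _ => and_congr_right fun _ => ⟨?_, ?_⟩
      · intro h1 z hz hxz hzy
        obtain ⟨w, h2, h3, h4⟩ := h1 (f z) ((h.pt _ (by omega) hi _).2 hz) ((h.le _ _).2 hxz)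
          ((h.lt _ _).2 hzy)
        obtain ⟨w, rfl⟩ := hconv z y w h2.1 h3
        exact ⟨w, (h.lt _ _).1 h2, (h.le _ _).1 h3, (hs _ _).1 h4⟩
      · intro h1 z hz hxz hzy
        obtain ⟨z, rfl⟩ := hconv x y z hxz hzy.1
        obtain ⟨w, h2, h3, h4⟩ := h1 z ((h.pt _ (by omega) hi _).1 hz) ((h.le _ _).1 hxz)
          ((h.lt _ _).1 hzy)
        exact ⟨f w, (h.lt _ _).2 h2, (h.le _ _).2 h3, (hs _ _).2 h4⟩
    have hex : ∀ p : B → Prop, (∃ x ∈ D, p x) ↔ ∃ x ∈ f ⁻¹' D, p (f x) := by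
      intro p
      constructor
      · rintro ⟨x, hx, hp⟩
        obtain ⟨x, rfl⟩ := hD hx
        exact ⟨x, hx, hp⟩
      · rintro ⟨x, hx, hp⟩
        exact ⟨f x, hx, hp⟩
    simp only [SomeTotal, hex, hs, ht, h.R _ (Nat.le_add_left 1 i) hi, h.le, h.lt,
      h.pt _ (Nat.le_add_left 1 i) hi, h.S 1 le_rfl (by omega : 1 ≤ n)]

theorem IsLO.of_emb {n : ℕ} {f : A → B} (h : Emb n d e f) (hLO : e.IsLO) : d.IsLO where
  refl _ := (h.le _ _).1 (hLO.refl _)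
  antisymm _ _ h1 h2 := h.inj (hLO.antisymm _ _ ((h.le _ _).2 h1) ((h.le _ _).2 h2))
  trans _ _ _ h1 h2 := (h.le _ _).1 (hLO.trans _ _ _ ((h.le _ _).2 h1) ((h.le _ _).2 h2))
  total x y := (hLO.total (f x) (f y)).imp (h.le _ _).1 (h.le _ _).1

end Dat

/-! ### The semantics of the sentences `SomeTotalR_i` -/

/-- The interpretation of the symbols of `σ_n` in a structure; a symbol whose index is out of range
is interpreted by the empty relation. -/
def datOf (n : ℕ) (A : Type) [(sigmaLang n).Structure A] : Dat A where
  le x y := Structure.RelMap (leSym n) ![x, y]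
  S i x y := ∃ h, Structure.RelMap (sSymb n i h) ![x, y]
  R i x y := ∃ h, Structure.RelMap (rSymb n i h) ![x, y]
  P i x := ∃ h, Structure.RelMap (pSymb n i h) ![x]

/-- The induced substructure on a subset; it may be empty. -/
abbrev subStructure {n : ℕ} {A : Type} [(sigmaLang n).Structure A] (p : A → Prop) :
    (sigmaLang n).Structure {z : A // p z} where
  funMap f := f.elim
  RelMap r v := Structure.RelMap r (Subtype.val ∘ v)

theorem realize_leF {n k : ℕ} {α A : Type} [(sigmaLang n).Structure A]
    {s t : (sigmaLang n).Term (α ⊕ Fin k)} {v : α → A} {xs : Fin k → A} :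
    (leF s t).Realize v xs ↔
      (datOf n A).le (s.realize (Sum.elim v xs)) (t.realize (Sum.elim v xs)) := by
  simp [leF, datOf, BoundedFormula.realize_rel₂]

theorem realize_ltF {n k : ℕ} {α A : Type} [(sigmaLang n).Structure A]
    {s t : (sigmaLang n).Term (α ⊕ Fin k)} {v : α → A} {xs : Fin k → A} :
    (ltF s t).Realize v xs ↔
      (datOf n A).lt (s.realize (Sum.elim v xs)) (t.realize (Sum.elim v xs)) := by
  simp [ltF, realize_leF, Dat.lt]

theorem realize_NLO {n : ℕ} {A : Type} [(sigmaLang n).Structure A] :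
    A ⊨ NLO n ↔ ¬ (datOf n A).IsLO := by
  rw [Dat.isLO_iff]
  simp only [NLO, Sentence.Realize, Formula.realize_not]
  refine not_congr ?_
  simp only [Formula.Realize, BoundedFormula.realize_inf, and_assoc]
  refine and_congr ?_ (and_congr ?_ (and_congr ?_ ?_))
  · exact (Relations.realize_reflexive (M := A) (r := leSym n)).trans ⟨fun h x => h.refl x, fun h => ⟨h⟩⟩
  · exact (Relations.realize_antisymmetric (M := A) (r := leSym n)).trans
      ⟨fun h x y => h.antisymm x y, fun h => ⟨h⟩⟩
  · exact (Relations.realize_transitive (M := A) (r := leSym n)).trans ⟨fun h x y z => h.trans x y z, fun h => ⟨h⟩⟩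
  · exact (Relations.realize_total (M := A) (r := leSym n)).trans ⟨fun h x y => h.total x y, fun h => ⟨h⟩⟩

theorem realize_relativizeStar {n : ℕ} {A : Type} [(sigmaLang n).Structure A] (a b : A) {k : ℕ}
    (φ : (sigmaLang n).BoundedFormula Empty k)
    (xs : Fin k → {z : A // z ∈ (datOf n A).Icc a b}) (v : Empty → {z : A // z ∈ (datOf n A).Icc a b}) :
    (relativizeStar φ).Realize ![a, b] (Subtype.val ∘ xs) ↔
      @BoundedFormula.Realize _ _ (subStructure (· ∈ (datOf n A).Icc a b)) _ _ φ v xs := by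
  let := subStructure (n := n) (· ∈ (datOf n A).Icc a b)
  have ht : ∀ {k : ℕ} (t : (sigmaLang n).Term (Empty ⊕ Fin k))
      (xs : Fin k → {z : A // z ∈ (datOf n A).Icc a b}),
      (t.relabel (Sum.map Empty.elim id)).realize (Sum.elim ![a, b] (Subtype.val ∘ xs)) =
        (t.realize (Sum.elim v xs)).1 := by
    intro k t xs
    rcases t with (e | i) | ⟨f, _⟩
    · exact e.elim
    · rfl
    · exact Empty.elim f
  induction φ with
  | falsum => rfl
  | equal s t =>
    change Term.realize _ _ = Term.realize _ _ ↔ Term.realize _ _ = Term.realize _ _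
    rw [ht, ht, Subtype.ext_iff]
  | rel r ts =>
    change Structure.RelMap r _ ↔ Structure.RelMap r (Subtype.val ∘ _)
    refine iff_of_eq (congrArg _ (funext fun j => ht _ _))
  | imp φ ψ ih1 ih2 => exact imp_congr (ih1 xs) (ih2 xs)
  | @all k φ ih =>
    simp only [relativizeStar, BoundedFormula.realize_all, BoundedFormula.realize_imp,
      BoundedFormula.realize_inf, realize_leF]
    have hs : ∀ z : {z : A // z ∈ (datOf n A).Icc a b},
        (Fin.snoc (Subtype.val ∘ xs) z.1 : Fin (k + 1) → A) = Subtype.val ∘ Fin.snoc xs z := by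
      intro z
      ext j
      refine Fin.lastCases ?_ (fun j => ?_) j <;> simp
    constructor
    · intro h z
      refine (ih _).1 ?_
      rw [← hs]
      exact h z.1 (by simpa [Dat.Icc] using z.2)
    · intro h z hz
      have := (ih _).2 (h ⟨z, by simpa [Dat.Icc] using hz⟩)
      rwa [← hs] at this

theorem emb_subtype {n : ℕ} {A : Type} [(sigmaLang n).Structure A] (p : A → Prop) (m : ℕ) :
    letI := subStructure (n := n) p
    Dat.Emb m (datOf n {z : A // p z}) (datOf n A) Subtype.val := by
  have h2 : ∀ x y : {z // p z}, Subtype.val ∘ ![x, y] = ![x.1, y.1] := by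
    intro x y; ext j; fin_cases j <;> rfl
  have h1 : ∀ x : {z // p z}, Subtype.val ∘ ![x] = ![x.1] := by
    intro x; ext j; fin_cases j; rfl
  refine ⟨Subtype.val_injective, ?_, ?_, ?_, ?_⟩ <;>
    simp [datOf, Dat.pt, Structure.RelMap, h1, h2]

theorem realize_applyVars {n k : ℕ} {A : Type} [(sigmaLang n).Structure A]
    (φ : (sigmaLang n).Formula (Fin 2)) (x y : Fin k) (v : Empty → A) (xs : Fin k → A) :
    (applyVars φ x y).Realize v xs ↔ φ.Realize ![xs x, xs y] := by
  unfold applyVars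
  rw [BoundedFormula.realize_relabel, Formula.Realize]
  refine iff_of_eq (congrArg₂ _ ?_ (Subsingleton.elim _ _))
  ext j
  fin_cases j <;> simp

/-- Over linear orders, `someTotalRAux n i` says what `Dat.SomeTotal` says; by induction on `i`,
the relativized copies being evaluated in the intervals as structures of their own. -/
theorem realize_someTotalRAux {n : ℕ} (i : ℕ) (h : 1 ≤ i) (h' : i ≤ n) {A : Type}
    [(sigmaLang n).Structure A] (hLO : (datOf n A).IsLO) :
    A ⊨ someTotalRAux n i h h' ↔
      (datOf n A).SomeTotal (datOf n A).total i Set.univ := by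
  induction i generalizing A with
  | zero => omega
  | succ i ih =>
    cases i with
    | zero =>
      have hS : ∀ x y : A, Structure.RelMap (sSymb n 1 ⟨h, h'⟩) ![x, y] ↔ (datOf n A).S 1 x y :=
        fun x y => ⟨fun h1 => ⟨_, h1⟩, fun ⟨_, h1⟩ => h1⟩
      have hR : ∀ x y : A, Structure.RelMap (rSymb n 1 ⟨h, h'⟩) ![x, y] ↔ (datOf n A).R 1 x y :=
        fun x y => ⟨fun h1 => ⟨_, h1⟩, fun ⟨_, h1⟩ => h1⟩
      have hlt : ∀ x y : A, (datOf n A).lt x y → (datOf n A).le x y := fun x y h => h.1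
      simp only [someTotalRAux, partialSuccOne, totalOne, Sentence.Realize, Formula.Realize,
        BoundedFormula.realize_sup, BoundedFormula.realize_not, BoundedFormula.realize_all,
        BoundedFormula.realize_ex, BoundedFormula.realize_imp, BoundedFormula.realize_inf,
        realize_leF, realize_ltF, BoundedFormula.realize_rel₂, hS, hR]
      simp only [Dat.SomeTotal, Dat.succRel, Dat.total, Dat.pt]
      simp only [← or_assoc]
      simp
      refine or_congr ⟨?_, ?_⟩ ⟨?_, ?_⟩
      · rintro ⟨x, y, h1, h2⟩
        by_cases h3 : (datOf n A).lt x y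
        · exact Or.inr ⟨x, y, ⟨h1, h3.1⟩, h2 h3⟩
        · exact Or.inl ⟨x, y, h1, h3⟩
      · rintro (⟨x, y, h1, h2⟩ | ⟨x, y, h1, h2⟩)
        · exact ⟨x, y, h1, fun h3 => absurd h3 h2⟩
        · exact ⟨x, y, h1.1, fun _ => h2⟩
      · rintro ⟨x, y, h1, h2, h3⟩
        refine ⟨x, y, h1, h2, fun z h4 h5 => ?_⟩
        obtain ⟨w, ⟨h6, h7⟩, h8⟩ := h3 z h4 h5
        exact ⟨w, h6, h7, h8, h6.1⟩
      · rintro ⟨x, y, h1, h2, h3⟩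
        refine ⟨x, y, h1, h2, fun z h4 h5 => ?_⟩
        obtain ⟨w, h6, h7, h8, _⟩ := h3 z h4 h5
        exact ⟨w, ⟨h6, h7⟩, h8⟩
    | succ i =>
      have hS : ∀ x y : A, Structure.RelMap (sSymb n (i + 2) ⟨h, h'⟩) ![x, y] ↔
          (datOf n A).S (i + 2) x y := fun x y => ⟨fun h1 => ⟨_, h1⟩, fun ⟨_, h1⟩ => h1⟩
      have hR : ∀ x y : A, Structure.RelMap (rSymb n (i + 2) ⟨h, h'⟩) ![x, y] ↔
          (datOf n A).R (i + 2) x y := fun x y => ⟨fun h1 => ⟨_, h1⟩, fun ⟨_, h1⟩ => h1⟩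
      have hP : ∀ x : A, Structure.RelMap (pSymb n (i + 2) ⟨by omega, h'⟩) ![x] ↔
          (datOf n A).pt (i + 2) x :=
        fun x => ⟨fun h1 => Or.inr ⟨_, h1⟩, fun h1 => (h1.resolve_left (by omega)).2⟩
      have hrel : ∀ x y : A,
          (relativize (someTotalRAux n (i + 1) (by omega) (by omega))).Realize ![x, y] ↔
          (datOf n A).le x y ∧
            (datOf n A).SomeTotal (datOf n A).total (i + 1) ((datOf n A).Icc x y) := by
        intro x y
        rw [relativize, Formula.realize_inf]
        refine and_congr (by simp [Formula.Realize, realize_leF]) ?_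
        let := subStructure (n := n) (· ∈ (datOf n A).Icc x y)
        have hemb := emb_subtype (n := n) (· ∈ (datOf n A).Icc x y) (i + 1)
        have h1 := realize_relativizeStar (n := n) x y
          (someTotalRAux n (i + 1) (by omega) (by omega)) default default
        rw [Formula.Realize, Subsingleton.elim (default : Fin 0 → A) (Subtype.val ∘
          (default : Fin 0 → {z : A // z ∈ (datOf n A).Icc x y}))]
        refine h1.trans ((ih (by omega) (by omega) (hLO.of_emb hemb)).trans ?_)
        rw [hemb.someTotal_total_iff ?_ le_rfl (by simp)]
        · refine iff_of_eq (congrArg _ ?_)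
          ext z
          simp
        · intro u v z h1 h2
          simpa using hLO.Icc_subset u.2 v.2 ⟨h1, h2⟩
      have hsucc : ∀ x y : A, BoundedFormula.Realize (succF n (i + 2) ⟨by omega, h'⟩
          (someTotalRAux n (i + 1) (by omega) (by omega))) ![x, y] default ↔
          (datOf n A).succRel (i + 2) ((datOf n A).SomeTotal (datOf n A).total (i + 1)) x y := by
        intro x y
        change Formula.Realize _ _ ↔ _
        simp only [succF, Formula.realize_inf, hrel, Formula.realize_rel₁, Formula.realize_rel₂,
          Dat.succRel, and_assoc]
        simp [hP, hS]
      simp only [someTotalRAux, partialSucc, totalF, Sentence.Realize, Formula.Realize,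
        BoundedFormula.realize_sup, BoundedFormula.realize_not, BoundedFormula.realize_all,
        BoundedFormula.realize_ex, BoundedFormula.realize_imp, BoundedFormula.realize_inf,
        realize_leF, realize_ltF, BoundedFormula.realize_rel₂, BoundedFormula.realize_rel₁,
        realize_applyVars, hsucc, hR, hP]
      rw [Dat.someTotal_succ]
      simp [Fin.snoc, and_assoc, Dat.total]

/-! ### Queries definable by prenex formulas of a given prefix class -/

section

variable {L : Language} {b : Bool} {m k : ℕ}

/-- The query `Q` is definable over nonempty structures by a formula of the given prefix class. -/
def PrefixDefinable (L : Language) (b : Bool) (m k : ℕ)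
    (Q : ∀ (A : Type) [L.Structure A], (Fin k → A) → Prop) : Prop :=
  ∃ φ : L.BoundedFormula Empty k, PrefixClass b m φ ∧
    ∀ (A : Type) [L.Structure A] [Nonempty A] (v : Fin k → A), φ.Realize default v ↔ Q A v

theorem PrefixClass.zero_isQF {α : Type} {φ : L.BoundedFormula α k} (h : PrefixClass b 0 φ) :
    φ.IsQF := by
  cases h
  assumption

theorem PrefixClass.mono {α : Type} {φ : L.BoundedFormula α k} (h : PrefixClass b m φ) :
    PrefixClass b (m + 1) φ := by
  induction h with
  | qf h => exact .qf h
  | ex _ ih => exact .ex ih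
  | all _ ih => exact .all ih
  | alternate _ ih => exact .alternate ih

theorem PrefixClass.mono_le {α : Type} {φ : L.BoundedFormula α k} (h : PrefixClass b m φ) {m' : ℕ}
    (hm : m ≤ m') : PrefixClass b m' φ := by
  induction hm with
  | refl => exact h
  | step _ ih => exact ih.mono

theorem exists_subst_isQF {φ : L.BoundedFormula Empty k} (h : φ.IsQF) {l : ℕ}
    (f : Fin k → Fin l) : ∃ ψ : L.BoundedFormula Empty l, ψ.IsQF ∧
      ∀ (A : Type) [L.Structure A] (v : Fin l → A),
        ψ.Realize default v ↔ φ.Realize default (v ∘ f) := by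
  have ht : ∀ (A : Type) [L.Structure A] (v : Fin l → A) (t : L.Term (Empty ⊕ Fin k)),
      (t.relabel (Sum.map id f)).realize (Sum.elim default v) =
        t.realize (Sum.elim default (v ∘ f)) := by
    intro A _ v t
    rw [Term.realize_relabel]
    congr 1
    ext (x | x) <;> rfl
  induction h with
  | falsum => exact ⟨⊥, .falsum, fun _ _ _ => Iff.rfl⟩
  | of_isAtomic h =>
    cases h with
    | equal s t =>
      refine ⟨(s.relabel (Sum.map id f)).bdEqual (t.relabel (Sum.map id f)),
        (BoundedFormula.IsAtomic.equal _ _).isQF, ?_⟩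
      intro A _ v
      simp only [BoundedFormula.realize_bdEqual, ht]
    | rel r ts =>
      refine ⟨r.boundedFormula fun j => (ts j).relabel (Sum.map id f),
        (BoundedFormula.IsAtomic.rel _ _).isQF, ?_⟩
      intro A _ v
      simp only [BoundedFormula.realize_rel, ht]
  | imp _ _ ih1 ih2 =>
    obtain ⟨ψ1, h1, h1'⟩ := ih1
    obtain ⟨ψ2, h2, h2'⟩ := ih2
    exact ⟨ψ1.imp ψ2, h1.imp h2, fun A _ v => imp_congr (h1' A v) (h2' A v)⟩

theorem snoc_comp_lift {A : Type} {l : ℕ} (f : Fin k → Fin l) (v : Fin l → A) (a : A) :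
    (Fin.snoc v a : Fin (l + 1) → A) ∘
      (Fin.snoc (fun i => (f i).castSucc) (Fin.last l) : Fin (k + 1) → Fin (l + 1)) =
      Fin.snoc (v ∘ f) a := by
  ext j
  refine Fin.lastCases ?_ (fun j => ?_) j <;> simp

theorem exists_subst_prefixClass {φ : L.BoundedFormula Empty k} (h : PrefixClass b m φ) {l : ℕ}
    (f : Fin k → Fin l) : ∃ ψ : L.BoundedFormula Empty l, PrefixClass b m ψ ∧
      ∀ (A : Type) [L.Structure A] (v : Fin l → A),
        ψ.Realize default v ↔ φ.Realize default (v ∘ f) := by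
  induction h generalizing l with
  | qf h =>
    obtain ⟨ψ, h1, h2⟩ := exists_subst_isQF h f
    exact ⟨ψ, .qf h1, h2⟩
  | ex _ ih =>
    obtain ⟨ψ, h1, h2⟩ := ih (Fin.snoc (fun i => (f i).castSucc) (Fin.last l))
    refine ⟨ψ.ex, .ex h1, fun A _ v => ?_⟩
    simp only [BoundedFormula.realize_ex, h2, snoc_comp_lift]
  | all _ ih =>
    obtain ⟨ψ, h1, h2⟩ := ih (Fin.snoc (fun i => (f i).castSucc) (Fin.last l))
    refine ⟨ψ.all, .all h1, fun A _ v => ?_⟩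
    simp only [BoundedFormula.realize_all, h2, snoc_comp_lift]
  | alternate _ ih =>
    obtain ⟨ψ, h1, h2⟩ := ih f
    exact ⟨ψ, .alternate h1, h2⟩

theorem exists_weaken_prefixClass {φ : L.BoundedFormula Empty k} (h : PrefixClass b m φ) :
    ∃ ψ : L.BoundedFormula Empty (k + 1), PrefixClass b m ψ ∧
      ∀ (A : Type) [L.Structure A] (v : Fin k → A) (a : A),
        ψ.Realize default (Fin.snoc v a) ↔ φ.Realize default v := by
  obtain ⟨ψ, h1, h2⟩ := exists_subst_prefixClass h Fin.castSucc
  refine ⟨ψ, h1, fun A _ v a => ?_⟩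
  rw [h2]
  refine iff_of_eq (congrArg _ ?_)
  ext j
  simp

namespace PrefixDefinable

variable {Q Q' : ∀ (A : Type) [L.Structure A], (Fin k → A) → Prop}

theorem congr (h : PrefixDefinable L b m k Q)
    (hQ : ∀ (A : Type) [L.Structure A] [Nonempty A] (v : Fin k → A), Q A v ↔ Q' A v) :
    PrefixDefinable L b m k Q' := by
  obtain ⟨φ, h1, h2⟩ := h
  exact ⟨φ, h1, fun A _ _ v => (h2 A v).trans (hQ A v)⟩

theorem mono_le (h : PrefixDefinable L b m k Q) {m' : ℕ} (hm : m ≤ m') : PrefixDefinable L b m' k Q := by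
  obtain ⟨φ, h1, h2⟩ := h
  exact ⟨φ, h1.mono_le hm, h2⟩

theorem alternate (h : PrefixDefinable L (!b) m k Q) : PrefixDefinable L b (m + 1) k Q := by
  obtain ⟨φ, h1, h2⟩ := h
  exact ⟨φ, .alternate h1, h2⟩

theorem ex {Q : ∀ (A : Type) [L.Structure A], (Fin k → A) → A → Prop}
    (h : PrefixDefinable L true (m + 1) (k + 1)
      fun A _ v => Q A (fun i => v i.castSucc) (v (Fin.last k))) :
    PrefixDefinable L true (m + 1) k fun A _ v => ∃ a, Q A v a := by
  obtain ⟨φ, h1, h2⟩ := h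
  refine ⟨φ.ex, .ex h1, fun A _ _ v => ?_⟩
  simp [BoundedFormula.realize_ex, h2]

theorem all {Q : ∀ (A : Type) [L.Structure A], (Fin k → A) → A → Prop}
    (h : PrefixDefinable L false (m + 1) (k + 1)
      fun A _ v => Q A (fun i => v i.castSucc) (v (Fin.last k))) :
    PrefixDefinable L false (m + 1) k fun A _ v => ∀ a, Q A v a := by
  obtain ⟨φ, h1, h2⟩ := h
  refine ⟨φ.all, .all h1, fun A _ _ v => ?_⟩
  simp [BoundedFormula.realize_all, h2]

theorem _root_.PrefixClass.exists_not {φ : L.BoundedFormula Empty k} (h : PrefixClass b m φ) :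
    ∃ ψ : L.BoundedFormula Empty k, PrefixClass (!b) m ψ ∧
      ∀ (A : Type) [L.Structure A] (v : Fin k → A),
        ψ.Realize default v ↔ ¬ φ.Realize default v := by
  induction h with
  | @qf _ _ _ φ h => exact ⟨∼φ, .qf h.not, fun A _ v => BoundedFormula.realize_not⟩
  | ex _ ih =>
    obtain ⟨ψ, h3, h4⟩ := ih
    exact ⟨ψ.all, .all h3, fun A _ v => by
      simp [BoundedFormula.realize_ex, BoundedFormula.realize_all, h4]⟩
  | all _ ih =>
    obtain ⟨ψ, h3, h4⟩ := ih
    exact ⟨ψ.ex, .ex h3, fun A _ v => by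
      simp [BoundedFormula.realize_ex, BoundedFormula.realize_all, h4]⟩
  | alternate _ ih =>
    obtain ⟨ψ, h3, h4⟩ := ih
    exact ⟨ψ, .alternate h3, h4⟩

theorem not (h : PrefixDefinable L b m k Q) :
    PrefixDefinable L (!b) m k fun A _ v => ¬ Q A v := by
  obtain ⟨φ, h1, h2⟩ := h
  obtain ⟨ψ, h3, h4⟩ := h1.exists_not
  exact ⟨ψ, h3, fun A _ _ v => (h4 A v).trans (not_congr (h2 A v))⟩

/-- Conjunction with a quantifier-free formula. -/
theorem _root_.PrefixClass.and_isQF {φ ψ : L.BoundedFormula Empty k} (h : PrefixClass b m φ)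
    (hψ : ψ.IsQF) : PrefixDefinable L b m k
      fun A _ v => φ.Realize (default : Empty → A) v ∧ ψ.Realize default v := by
  induction h with
  | @qf _ _ _ φ h =>
    exact ⟨φ ⊓ ψ, .qf (h.inf hψ), fun A _ _ v => BoundedFormula.realize_inf⟩
  | ex _ ih =>
    obtain ⟨ψ', h1, h2⟩ := exists_weaken_prefixClass (.qf (b := true) (m := 0) hψ)
    obtain ⟨χ, h3, h4⟩ := ih h1.zero_isQF
    refine ⟨χ.ex, .ex h3, fun A _ _ v => ?_⟩
    simp [BoundedFormula.realize_ex, h4, h2]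
  | all _ ih =>
    obtain ⟨ψ', h1, h2⟩ := exists_weaken_prefixClass (.qf (b := true) (m := 0) hψ)
    obtain ⟨χ, h3, h4⟩ := ih h1.zero_isQF
    refine ⟨χ.all, .all h3, fun A _ _ v => ?_⟩
    simp [BoundedFormula.realize_all, h4, h2, forall_and]
  | alternate _ ih => exact (ih hψ).alternate

/-- The conjunction of formulas of adjacent classes, given conjunctions in the lower class. -/
theorem _root_.PrefixClass.and_alternate
    (ih : ∀ {b : Bool} {k : ℕ} {φ ψ : L.BoundedFormula Empty k}, PrefixClass b m φ →
      PrefixClass b m ψ → PrefixDefinable L b m k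
        fun A _ v => φ.Realize (default : Empty → A) v ∧ ψ.Realize default v)
    {φ ψ : L.BoundedFormula Empty k} (hφ : PrefixClass (!b) m φ)
    (hψ : PrefixClass b (m + 1) ψ) : PrefixDefinable L b (m + 1) k
      fun A _ v => φ.Realize (default : Empty → A) v ∧ ψ.Realize default v := by
  generalize hm : m + 1 = m' at hψ
  induction hψ with
  | qf h => exact hm ▸ (PrefixClass.alternate hφ).and_isQF h
  | ex _ ih' =>
    obtain ⟨φ', h1, h2⟩ := exists_weaken_prefixClass hφ
    obtain ⟨χ, h3, h4⟩ := ih' h1 hm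
    refine ⟨χ.ex, hm ▸ .ex (hm ▸ h3), fun A _ _ v => ?_⟩
    simp [BoundedFormula.realize_ex, h4, h2]
  | all _ ih' =>
    obtain ⟨φ', h1, h2⟩ := exists_weaken_prefixClass hφ
    obtain ⟨χ, h3, h4⟩ := ih' h1 hm
    refine ⟨χ.all, hm ▸ .all (hm ▸ h3), fun A _ _ v => ?_⟩
    simp [BoundedFormula.realize_all, h4, h2, forall_and]
  | alternate h =>
    cases hm
    exact (ih hφ h).alternate

theorem _root_.PrefixClass.and {φ ψ : L.BoundedFormula Empty k} (hφ : PrefixClass b m φ)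
    (hψ : PrefixClass b m ψ) : PrefixDefinable L b m k
      fun A _ v => φ.Realize (default : Empty → A) v ∧ ψ.Realize default v := by
  induction m generalizing b k with
  | zero => exact hφ.and_isQF hψ.zero_isQF
  | succ m ihm =>
    generalize hm : m + 1 = m' at hφ
    induction hφ with
    | qf h => exact hm ▸ (hψ.and_isQF h).congr fun A _ _ v => and_comm
    | ex _ ih =>
      obtain ⟨ψ', h1, h2⟩ := exists_weaken_prefixClass hψ
      obtain ⟨χ, h3, h4⟩ := ih h1 hm
      refine ⟨χ.ex, hm ▸ .ex (hm ▸ h3), fun A _ _ v => ?_⟩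
      simp [BoundedFormula.realize_ex, h4, h2]
    | all _ ih =>
      obtain ⟨ψ', h1, h2⟩ := exists_weaken_prefixClass hψ
      obtain ⟨χ, h3, h4⟩ := ih h1 hm
      refine ⟨χ.all, hm ▸ .all (hm ▸ h3), fun A _ _ v => ?_⟩
      simp [BoundedFormula.realize_all, h4, h2, forall_and]
    | alternate h =>
      cases hm
      exact h.and_alternate ihm hψ

theorem and (h : PrefixDefinable L b m k Q) (h' : PrefixDefinable L b m k Q') :
    PrefixDefinable L b m k fun A _ v => Q A v ∧ Q' A v := by
  obtain ⟨φ, h1, h2⟩ := h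
  obtain ⟨ψ, h3, h4⟩ := h'
  exact (h1.and h3).congr fun A _ _ v => and_congr (h2 A v) (h4 A v)

theorem or (h : PrefixDefinable L b m k Q) (h' : PrefixDefinable L b m k Q') :
    PrefixDefinable L b m k fun A _ v => Q A v ∨ Q' A v := by
  have := (h.not.and h'.not).not
  rw [Bool.not_not] at this
  exact this.congr fun A _ _ v => by rw [not_and_or, not_not, not_not]

end PrefixDefinable

end

/-! ### `SomeTotalR_i` is equivalent to a `Σ_{2i+1}` sentence -/

section

variable {n : ℕ} {b : Bool} {m k : ℕ}

theorem prefixDefinable_const (p : Prop) :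
    PrefixDefinable (sigmaLang n) b m k fun _ _ _ => p := by
  by_cases hp : p
  · exact ⟨⊤, .qf .top, fun A _ _ v => by simp [hp]⟩
  · exact ⟨⊥, .qf .falsum, fun A _ _ v => by simp [hp]⟩

theorem prefixDefinable_eq (x y : Fin k) :
    PrefixDefinable (sigmaLang n) b m k fun _ _ v => v x = v y :=
  ⟨(&x).bdEqual (&y), .qf (BoundedFormula.IsAtomic.equal _ _).isQF, fun A _ _ v => by simp⟩

theorem prefixDefinable_rel₂ (r : (sigmaLang n).Relations 2) (x y : Fin k) :
    PrefixDefinable (sigmaLang n) b m k fun _ _ v => Structure.RelMap r ![v x, v y] :=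
  ⟨r.boundedFormula₂ (&x) (&y), .qf (BoundedFormula.IsAtomic.rel _ _).isQF,
    fun A _ _ v => by simp [BoundedFormula.realize_rel₂]⟩

theorem prefixDefinable_rel₁ (r : (sigmaLang n).Relations 1) (x : Fin k) :
    PrefixDefinable (sigmaLang n) b m k fun _ _ v => Structure.RelMap r ![v x] :=
  ⟨r.boundedFormula₁ (&x), .qf (BoundedFormula.IsAtomic.rel _ _).isQF,
    fun A _ _ v => by simp [BoundedFormula.realize_rel₁]⟩

theorem prefixDefinable_exists_prop {h : Prop}
    {Q : h → ∀ (A : Type) [(sigmaLang n).Structure A], (Fin k → A) → Prop}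
    (hQ : ∀ p, PrefixDefinable (sigmaLang n) b m k (Q p)) :
    PrefixDefinable (sigmaLang n) b m k fun A _ v => ∃ p, Q p A v := by
  by_cases hp : h
  · exact (hQ hp).congr fun A _ _ v => by simp [hp]
  · exact (prefixDefinable_const False).congr fun A _ _ v => by simp [hp]

theorem prefixDefinable_le (x y : Fin k) :
    PrefixDefinable (sigmaLang n) b m k fun A _ v => (datOf n A).le (v x) (v y) :=
  prefixDefinable_rel₂ _ x y

theorem prefixDefinable_S (i : ℕ) (x y : Fin k) :
    PrefixDefinable (sigmaLang n) b m k fun A _ v => (datOf n A).S i (v x) (v y) :=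
  prefixDefinable_exists_prop fun _ => prefixDefinable_rel₂ _ x y

theorem prefixDefinable_R (i : ℕ) (x y : Fin k) :
    PrefixDefinable (sigmaLang n) b m k fun A _ v => (datOf n A).R i (v x) (v y) :=
  prefixDefinable_exists_prop fun _ => prefixDefinable_rel₂ _ x y

theorem prefixDefinable_pt (i : ℕ) (x : Fin k) :
    PrefixDefinable (sigmaLang n) b m k fun A _ v => (datOf n A).pt i (v x) :=
  (prefixDefinable_const _).or
    (prefixDefinable_exists_prop fun _ => prefixDefinable_rel₁ _ x)

theorem prefixDefinable_not_eq (x y : Fin k) :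
    PrefixDefinable (sigmaLang n) b m k fun _ _ v => v x ≠ v y := by
  have := (prefixDefinable_eq (n := n) (b := !b) (m := m) x y).not
  rwa [Bool.not_not] at this

theorem prefixDefinable_not_le (x y : Fin k) :
    PrefixDefinable (sigmaLang n) b m k fun A _ v => ¬ (datOf n A).le (v x) (v y) := by
  have := (prefixDefinable_le (n := n) (b := !b) (m := m) x y).not
  rwa [Bool.not_not] at this

theorem prefixDefinable_not_pt (i : ℕ) (x : Fin k) :
    PrefixDefinable (sigmaLang n) b m k fun A _ v => ¬ (datOf n A).pt i (v x) := by
  have := (prefixDefinable_pt (n := n) (b := !b) (m := m) i x).not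
  rwa [Bool.not_not] at this

theorem prefixDefinable_lt (x y : Fin k) :
    PrefixDefinable (sigmaLang n) b m k fun A _ v => (datOf n A).lt (v x) (v y) :=
  (prefixDefinable_le x y).and (prefixDefinable_not_eq x y)

theorem prefixDefinable_not_lt (x y : Fin k) :
    PrefixDefinable (sigmaLang n) b m k fun A _ v => ¬ (datOf n A).lt (v x) (v y) := by
  have := (prefixDefinable_lt (n := n) (b := !b) (m := m) x y).not
  rwa [Bool.not_not] at this

/-- The quantifier prefix of `SomeTotalR_i`, relativized to a definable set `D`: the quantifier
alternation `∀ z ∃ w` of `Total_i` adds two blocks to that of `SomeTotalR_{i-1}`. -/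
theorem prefixDefinable_someTotal (i : ℕ) {k : ℕ}
    (D : ∀ (A : Type) [(sigmaLang n).Structure A], (Fin k → A) → Set A)
    (hD : ∀ {l : ℕ} (f : Fin k → Fin l) (x : Fin l),
      PrefixDefinable (sigmaLang n) true 1 l fun A _ v => v x ∈ D A (fun j => v (f j))) :
    PrefixDefinable (sigmaLang n) true (2 * i + 1) k
      fun A _ v => (datOf n A).SomeTotal (datOf n A).total i (D A v) := by
  induction i generalizing k with
  | zero => exact prefixDefinable_const True
  | succ i ih =>
    have hs : ∀ {l : ℕ} (x y : Fin l), PrefixDefinable (sigmaLang n) true (2 * i + 1) l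
        fun A _ v => (datOf n A).succRel (i + 1)
          ((datOf n A).SomeTotal (datOf n A).total i) (v x) (v y) := by
      intro l x y
      refine (prefixDefinable_pt _ x).and <| (prefixDefinable_pt _ y).and <|
        (prefixDefinable_S _ x y).and <| (prefixDefinable_le x y).and <|
        ih (fun A _ v => (datOf n A).Icc (v x) (v y)) ?_
      intro l f z
      exact (prefixDefinable_le _ _).and (prefixDefinable_le _ _)
    have hD' : ∀ {l : ℕ} (f : Fin k → Fin l) (x : Fin l),
        PrefixDefinable (sigmaLang n) true (2 * (i + 1) + 1) l
          fun A _ v => v x ∈ D A (fun j => v (f j)) := fun f x => (hD f x).mono_le (by omega)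
    have hs' : ∀ {l : ℕ} (x y : Fin l), PrefixDefinable (sigmaLang n) true (2 * (i + 1) + 1) l
        fun A _ v => (datOf n A).succRel (i + 1)
          ((datOf n A).SomeTotal (datOf n A).total i) (v x) (v y) :=
      fun x y => (hs x y).mono_le (by omega)
    have ht : ∀ {l : ℕ} (x y : Fin l), PrefixDefinable (sigmaLang n) true (2 * (i + 1) + 1) l
        fun A _ v => (datOf n A).total (i + 1) ((datOf n A).succRel (i + 1)
          ((datOf n A).SomeTotal (datOf n A).total i)) (v x) (v y) := by
      intro l x y
      have h1 : PrefixDefinable (sigmaLang n) true (2 * (i + 1) + 1) l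
          fun A _ v => ∀ z, ¬ (datOf n A).pt (i + 1) z ∨ ¬ (datOf n A).le (v x) z ∨
            ¬ (datOf n A).lt z (v y) ∨ ∃ w, (datOf n A).lt z w ∧ (datOf n A).le w (v y) ∧
              (datOf n A).succRel (i + 1) ((datOf n A).SomeTotal (datOf n A).total i) z w := by
        refine .alternate (.all (.or ?_ (.or ?_ (.or ?_
          (.alternate (.ex (.and ?_ (.and ?_ ?_))))))))
        · exact prefixDefinable_not_pt _ _
        · exact prefixDefinable_not_le _ _
        · exact prefixDefinable_not_lt _ _
        · exact prefixDefinable_lt _ _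
        · exact prefixDefinable_le _ _
        · exact hs _ _
      refine ((prefixDefinable_pt _ x).and ((prefixDefinable_lt x y).and h1)).congr
        fun A _ _ v => and_congr_right fun _ => and_congr_right fun _ => forall_congr' fun z => ?_
      tauto
    refine .or ?_ (.or ?_ ?_)
    · refine (prefixDefinable_const _).and (.ex (.and ?_ (.ex (.and ?_ (.and ?_ ?_)))))
      · exact hD' _ _
      · exact hD' _ _
      · exact prefixDefinable_S _ _ _
      · exact prefixDefinable_not_lt _ _
    · refine .ex (.and ?_ (.ex (.and ?_ (.and ?_ (.ex (.and ?_ (.and ?_ (.and ?_ ?_))))))))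
      · exact hD' _ _
      · exact hD' _ _
      · exact hs' _ _
      · exact hD' _ _
      · exact prefixDefinable_pt _ _
      · exact prefixDefinable_not_le _ _
      · exact prefixDefinable_not_le _ _
    · refine .ex (.and ?_ (.ex (.and ?_ (.and ?_ ?_))))
      · exact hD' _ _
      · exact hD' _ _
      · exact prefixDefinable_R _ _ _
      · exact ht _ _

theorem prefixDefinable_not_isLO :
    PrefixDefinable (sigmaLang n) true 1 k fun A _ _ => ¬ (datOf n A).IsLO := by
  have h : PrefixDefinable (sigmaLang n) false 1 k fun A _ _ =>
      (∀ x, (datOf n A).le x x) ∧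
      (∀ x y, ¬ (datOf n A).le x y ∨ ¬ (datOf n A).le y x ∨ x = y) ∧
      (∀ x y z, ¬ (datOf n A).le x y ∨ ¬ (datOf n A).le y z ∨ (datOf n A).le x z) ∧
      (∀ x y, (datOf n A).le x y ∨ (datOf n A).le y x) := by
    refine .and (.all ?_) (.and (.all (.all (.or ?_ (.or ?_ ?_)))) (.and
      (.all (.all (.all (.or ?_ (.or ?_ ?_))))) (.all (.all (.or ?_ ?_)))))
    all_goals
      first
      | exact prefixDefinable_le _ _
      | exact prefixDefinable_not_le _ _
      | exact prefixDefinable_eq _ _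
  refine h.not.congr fun A _ _ _ => not_congr ⟨fun h => ⟨h.1, ?_, ?_, h.2.2.2⟩, fun h =>
    ⟨h.refl, ?_, ?_, h.total⟩⟩
  · exact fun x y h1 h2 => ((h.2.1 x y).resolve_left (not_not.2 h1)).resolve_left (not_not.2 h2)
  · exact fun x y z h1 h2 =>
      ((h.2.2.1 x y z).resolve_left (not_not.2 h1)).resolve_left (not_not.2 h2)
  · exact fun x y => by have := h.antisymm x y; tauto
  · exact fun x y z => by have := h.trans x y z; tauto

end

/-! ### The path variant of `SomeTotalR_i` in existential transitive-closure logic -/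

namespace ETCFormula

variable {n m : ℕ}

/-- Falsity. As the language has no constant for it, it is expressed with the help of a variable. -/
def bot (a : Fin m) : ETCFormula (sigmaLang n) m := .neq a a

def le (a b : Fin m) : ETCFormula (sigmaLang n) m := .rel (leSym n) ![a, b]

def notLe (a b : Fin m) : ETCFormula (sigmaLang n) m := .negRel (leSym n) ![a, b]

/-- `S_i(a, b)`, which is false for an index out of range, as in `datOf`. -/
def S (i : ℕ) (a b : Fin m) : ETCFormula (sigmaLang n) m :=
  if h : 1 ≤ i ∧ i ≤ n then .rel (sSymb n i h) ![a, b] else bot a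

/-- `R_i(a, b)`, with the convention of `S`. -/
def R (i : ℕ) (a b : Fin m) : ETCFormula (sigmaLang n) m :=
  if h : 1 ≤ i ∧ i ≤ n then .rel (rSymb n i h) ![a, b] else bot a

/-- Membership in `P_i`, with the conventions of `Dat.pt` and `datOf`. -/
def pt (i : ℕ) (a : Fin m) : ETCFormula (sigmaLang n) m :=
  if i = 1 then .eq a a else if h : 2 ≤ i ∧ i ≤ n then .rel (pSymb n i h) ![a] else bot a

/-- `Succ_i(a, b)`, where `T` says that the interval satisfies `SomeTotalR_{i-1}`. -/
def succRel (i : ℕ) (T : ETCFormula (sigmaLang n) m) (a b : Fin m) : ETCFormula (sigmaLang n) m :=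
  (pt i a).and <| (pt i b).and <| (S i a b).and <| (le a b).and T

/-- The path variant of `SomeTotalR_i` on the interval between the variables `a` and `b`. -/
def someTotal : ℕ → ∀ {m : ℕ}, Fin m → Fin m → ETCFormula (sigmaLang n) m
  | 0, _, a, _ => .eq a a
  | i + 1, m, a, b =>
    let mem {l : ℕ} (f : Fin m → Fin l) (x : Fin l) : ETCFormula (sigmaLang n) l :=
      (le (f a) x).and (le x (f b))
    let a₁ : Fin m → Fin (m + 1) := Fin.castSucc
    let a₂ : Fin m → Fin (m + 1 + 1) := fun j => j.castSucc.castSucc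
    let a₃ : Fin m → Fin (m + 1 + 1 + 1) := fun j => j.castSucc.castSucc.castSucc
    let x₁ : Fin (m + 1) := Fin.last m
    let x₂ : Fin (m + 1 + 1) := (Fin.last m).castSucc
    let y₂ : Fin (m + 1 + 1) := Fin.last (m + 1)
    let x₃ : Fin (m + 1 + 1 + 1) := (Fin.last m).castSucc.castSucc
    let y₃ : Fin (m + 1 + 1 + 1) := (Fin.last (m + 1)).castSucc
    let z₃ : Fin (m + 1 + 1 + 1) := Fin.last (m + 1 + 1)
    let descent : ETCFormula (sigmaLang n) m :=
      if i = 0 then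
        .ex <| (mem a₁ x₁).and <| .ex <| (mem a₂ y₂).and <|
          (S 1 x₂ y₂).and <| (notLe x₂ y₂).or (.eq x₂ y₂)
      else bot a
    let violation : ETCFormula (sigmaLang n) m :=
      .ex <| (mem a₁ x₁).and <| .ex <| (mem a₂ y₂).and <|
        (succRel (i + 1) (someTotal i x₂ y₂) x₂ y₂).and <| .ex <| (mem a₃ z₃).and <|
          (pt (i + 1) z₃).and <| (notLe z₃ x₃).and (notLe y₃ z₃)
    let path : ETCFormula (sigmaLang n) m :=
      .ex <| (mem a₁ x₁).and <| .ex <| (mem a₂ y₂).and <| (R (i + 1) x₂ y₂).and <|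
        .tc (k := 1)
          ((succRel (i + 1)
              (someTotal i (Fin.last (m + 1 + 1)).castSucc (Fin.last (m + 1 + 1 + 1)))
              (Fin.last (m + 1 + 1)).castSucc (Fin.last (m + 1 + 1 + 1))).and <|
            (le (Fin.last (m + 1 + 1)).castSucc (Fin.last (m + 1 + 1 + 1))).and <|
              .neq (Fin.last (m + 1 + 1)).castSucc (Fin.last (m + 1 + 1 + 1)))
          ![x₂] ![y₂]
    descent.or (violation.or path)

variable {A : Type} [(sigmaLang n).Structure A]

theorem _root_.comp_pair {α β : Type} (s : α → β) (a b : α) : s ∘ ![a, b] = ![s a, s b] := by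
  ext j; fin_cases j <;> rfl

theorem _root_.comp_single {α β : Type} (s : α → β) (a : α) : s ∘ ![a] = ![s a] := by
  ext j; fin_cases j; rfl

theorem realize_bot (a : Fin m) (s : Fin m → A) :
    (bot (n := n) a).Realize s ↔ False := by
  simp [bot, Realize]

theorem realize_le (a b : Fin m) (s : Fin m → A) :
    (le (n := n) a b).Realize s ↔ (datOf n A).le (s a) (s b) := by
  simp [le, Realize, datOf, comp_pair]

theorem realize_notLe (a b : Fin m) (s : Fin m → A) :
    (notLe (n := n) a b).Realize s ↔ ¬ (datOf n A).le (s a) (s b) := by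
  simp [notLe, Realize, datOf, comp_pair]

theorem realize_S (i : ℕ) (a b : Fin m) (s : Fin m → A) :
    (S (n := n) i a b).Realize s ↔ (datOf n A).S i (s a) (s b) := by
  by_cases h : 1 ≤ i ∧ i ≤ n <;> simp [S, h, realize_bot, Realize, datOf, comp_pair]

theorem realize_R (i : ℕ) (a b : Fin m) (s : Fin m → A) :
    (R (n := n) i a b).Realize s ↔ (datOf n A).R i (s a) (s b) := by
  by_cases h : 1 ≤ i ∧ i ≤ n <;> simp [R, h, realize_bot, Realize, datOf, comp_pair]

theorem realize_pt (i : ℕ) (a : Fin m) (s : Fin m → A) :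
    (pt (n := n) i a).Realize s ↔ (datOf n A).pt i (s a) := by
  by_cases h1 : i = 1
  · simp [pt, h1, Realize, Dat.pt]
  · by_cases h : 2 ≤ i ∧ i ≤ n <;>
      simp [pt, h, h1, realize_bot, Realize, datOf, comp_single, Dat.pt]

theorem realize_someTotal (i : ℕ) (a b : Fin m) (s : Fin m → A) :
    (someTotal (n := n) i a b).Realize s ↔
      (datOf n A).SomeTotal (datOf n A).path i ((datOf n A).Icc (s a) (s b)) := by
  induction i generalizing m with
  | zero => simp [someTotal, Realize, Dat.SomeTotal]
  | succ i ih =>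
    have happ : ∀ {l : ℕ} (s : Fin l → A) (x y : Fin 1 → A),
        (Fin.append (Fin.append s x) y (Fin.last l).castSucc = x 0 ∧
          Fin.append (Fin.append s x) y (Fin.last (l + 1)) = y 0) := by
      intro l s x y
      constructor
      · have : (Fin.last l).castSucc = Fin.castAdd 1 (Fin.natAdd l (0 : Fin 1)) := rfl
        rw [this, Fin.append_left, Fin.append_right]
      · have : (Fin.last (l + 1)) = Fin.natAdd (l + 1) (0 : Fin 1) := rfl
        rw [this, Fin.append_right]
    have htc : ∀ (σ : A → A → Prop) (x y : A),
        Relation.TransGen (fun u v : Fin 1 → A => σ (u 0) (v 0)) ![x] ![y] ↔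
          Relation.TransGen σ x y := by
      intro σ x y
      exact ⟨fun h => h.lift (fun u : Fin 1 → A => u 0) (fun _ _ h => h) _ _,
        fun h => h.lift (fun u : A => ![u]) (fun _ _ h => h) _ _⟩
    rw [Dat.someTotal_succ]
    simp only [someTotal]
    have hsucc : ∀ {l : ℕ} (s : Fin l → A) (x y : Fin l),
        (succRel (n := n) (i + 1) (someTotal i x y) x y).Realize s ↔
          (datOf n A).succRel (i + 1) ((datOf n A).SomeTotal (datOf n A).path i) (s x) (s y) := by
      intro l s x y
      simp only [succRel, Realize, realize_pt, realize_S, realize_le, ih, Dat.succRel]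
    refine or_congr ?_ (or_congr ?_ ?_)
    · by_cases hi : i = 0 <;>
        simp [hi, Realize, realize_bot, realize_le, realize_notLe, realize_S, Dat.Icc, Dat.lt,
          imp_iff_not_or]
    · simp [Realize, hsucc, realize_le, realize_notLe, realize_pt, Dat.Icc]
    · simp only [Realize, hsucc, realize_le, realize_R, happ, comp_single, Dat.Icc, Dat.path]
      have htc' := htc fun u v =>
        (datOf n A).succRel (i + 1) ((datOf n A).SomeTotal (datOf n A).path i) u v ∧
          (datOf n A).le u v ∧ u ≠ v
      simp only [← htc', Fin.snoc_last, Fin.snoc_castSucc, Set.mem_ofPred_eq, Dat.lt]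

/-- `NLO` in existential transitive-closure logic. -/
def notLinear : ETCFormula (sigmaLang n) 0 :=
  (ETCFormula.ex (notLe (m := 1) 0 0)).or <|
  (ETCFormula.ex <| .ex <| (le (m := 2) 1 0).and <| (le 0 1).and (.neq 0 1)).or <|
  (ETCFormula.ex <| .ex <| .ex <| (le (m := 3) 1 2).and <| (le 0 1).and (notLe 0 2)).or <|
  (ETCFormula.ex <| .ex <| (notLe (m := 2) 0 1).and (notLe 1 0))

theorem realize_notLinear : (notLinear (n := n)).Realize (Fin.elim0 : Fin 0 → A) ↔
    ¬ (datOf n A).IsLO := by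
  rw [Dat.isLO_iff]
  simp only [notLinear, Realize, realize_le, realize_notLe, not_and_or, not_forall, not_or]
  simp [Fin.snoc]

end ETCFormula

/-! ### The path variant of `SomeTotalR_i` in Datalog with negation -/

/-- The intensional predicates: the goal, `SomeTotalR_i` on intervals for `i ≤ n`, and, for the
level `i + 1` with `i < n`, the successor relation and the ascending paths along it. -/
inductive SomeTotalIdb (n : ℕ) : Type
  | goal
  | some (i : Fin (n + 1))
  | succ (i : Fin n)
  | path (i : Fin n)

namespace SomeTotalIdb

variable {n : ℕ}

abbrev arity : SomeTotalIdb n → ℕ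
  | .goal => 0
  | _ => 2

instance : Finite (SomeTotalIdb n) := by
  let f : SomeTotalIdb n → Unit ⊕ Fin (n + 1) ⊕ Fin n ⊕ Fin n := fun
    | .goal => .inl ()
    | .some i => .inr (.inl i)
    | .succ i => .inr (.inr (.inl i))
    | .path i => .inr (.inr (.inr i))
  refine Finite.of_injective f fun x y h => ?_
  cases x <;> cases y <;> simp_all [f]

abbrev Lit (n : ℕ) := DatalogLit (sigmaLang n) (SomeTotalIdb n) arity

abbrev Rule (n : ℕ) := DatalogRule (sigmaLang n) (SomeTotalIdb n) arity

def le (x y : ℕ) : Lit n := .edb (leSym n) ![x, y]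

def notLe (x y : ℕ) : Lit n := .negEdb (leSym n) ![x, y]

/-- `S_{i+1}(x, y)`; the levels are counted from `0` here, to stay in the range of the symbols. -/
def S (i : Fin n) (x y : ℕ) : Lit n := .edb (sSymb n (i + 1) ⟨by omega, i.2⟩) ![x, y]

def R (i : Fin n) (x y : ℕ) : Lit n := .edb (rSymb n (i + 1) ⟨by omega, i.2⟩) ![x, y]

/-- Membership in `P_{i+1}`; the literal is a tautology for `i = 0`. -/
def pt (i : Fin n) (x : ℕ) : Lit n :=
  if h : i.1 = 0 then .eq x x else .edb (pSymb n (i + 1) ⟨by omega, i.2⟩) ![x]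

def someLit (i : Fin (n + 1)) (x y : ℕ) : Lit n := .idb (.some i) ![x, y]

def succLit (i : Fin n) (x y : ℕ) : Lit n := .idb (.succ i) ![x, y]

def pathLit (i : Fin n) (x y : ℕ) : Lit n := .idb (.path i) ![x, y]

/-- The rules for the goal, which is reached if `≤` is not a linear order or some interval satisfies
`SomeTotalR_n`, and the rule for level `0`, where every interval qualifies. -/
def goalRules (n : ℕ) : List (Rule n) :=
  [⟨.goal, ![], [notLe 0 0]⟩,
   ⟨.goal, ![], [le 0 1, le 1 0, .neq 0 1]⟩,
   ⟨.goal, ![], [le 0 1, le 1 2, notLe 0 2]⟩,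
   ⟨.goal, ![], [notLe 0 1, notLe 1 0]⟩,
   ⟨.goal, ![], [someLit (Fin.last n) 0 1]⟩,
   ⟨.some 0, ![0, 1], []⟩]

/-- In the rules for `SomeTotalR_{i+1}`, the interval has the endpoints `0` and `1`. -/
def levelRules (i : Fin n) : List (Rule n) :=
  [⟨.succ i, ![0, 1], [pt i 0, pt i 1, S i 0 1, le 0 1, someLit i.castSucc 0 1]⟩,
   ⟨.path i, ![0, 1], [succLit i 0 1, le 0 1, .neq 0 1]⟩,
   ⟨.path i, ![0, 2], [pathLit i 0 1, succLit i 1 2, le 1 2, .neq 1 2]⟩,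
   ⟨.some i.succ, ![0, 1], [le 0 2, le 2 1, le 0 3, le 3 1, succLit i 2 3,
      le 0 4, le 4 1, pt i 4, notLe 4 2, notLe 3 4]⟩,
   ⟨.some i.succ, ![0, 1], [le 0 2, le 2 1, le 0 3, le 3 1, R i 2 3, pathLit i 2 3]⟩] ++
  if i.1 = 0 then
    [⟨.some i.succ, ![0, 1], [le 0 2, le 2 1, le 0 3, le 3 1, S i 2 3, notLe 2 3]⟩,
     ⟨.some i.succ, ![0, 1], [le 0 2, le 2 1, le 0 3, le 3 1, S i 2 3, .eq 2 3]⟩]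
  else []

/-- The rules of the program for `NLO ∨ SomeTotalR_n`. -/
def rules (n : ℕ) : List (Rule n) := goalRules n ++ (List.finRange n).flatMap levelRules

/-- The program for `NLO ∨ SomeTotalR_n`. -/
def program (n : ℕ) : DatalogProgram (sigmaLang n) where
  Idb := SomeTotalIdb n
  finite_idb := inferInstance
  arity := arity
  rules := rules n
  goal := .goal
  arity_goal := rfl

variable {A : Type} [(sigmaLang n).Structure A]

/-- The intended interpretation of the intensional predicates. -/
def intended (A : Type) [(sigmaLang n).Structure A] :
    ∀ i : SomeTotalIdb n, (Fin (arity i) → A) → Prop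
  | .goal, _ => ¬ (datOf n A).IsLO ∨ (datOf n A).SomeTotal (datOf n A).path n Set.univ
  | .some i, v => (datOf n A).SomeTotal (datOf n A).path i
      ((datOf n A).Icc (v (0 : Fin 2)) (v (1 : Fin 2)))
  | .succ i, v => (datOf n A).succRel (i + 1) ((datOf n A).SomeTotal (datOf n A).path i)
      (v (0 : Fin 2)) (v (1 : Fin 2))
  | .path i, v => (datOf n A).path (i + 1)
      ((datOf n A).succRel (i + 1) ((datOf n A).SomeTotal (datOf n A).path i))
      (v (0 : Fin 2)) (v (1 : Fin 2))

variable {I : ∀ i : SomeTotalIdb n, (Fin (arity i) → A) → Prop} {s : ℕ → A}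

theorem holds_le {x y : ℕ} : (le (n := n) x y).Holds I s ↔ (datOf n A).le (s x) (s y) := by
  simp [le, DatalogLit.Holds, datOf, comp_pair]

theorem holds_notLe {x y : ℕ} :
    (notLe (n := n) x y).Holds I s ↔ ¬ (datOf n A).le (s x) (s y) := by
  simp [notLe, DatalogLit.Holds, datOf, comp_pair]

theorem holds_S {i : Fin n} {x y : ℕ} :
    (S i x y).Holds I s ↔ (datOf n A).S (i + 1) (s x) (s y) := by
  have : i.1 + 1 ≤ n := i.2
  simp [S, DatalogLit.Holds, datOf, comp_pair, this]

theorem holds_R {i : Fin n} {x y : ℕ} :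
    (R i x y).Holds I s ↔ (datOf n A).R (i + 1) (s x) (s y) := by
  have : i.1 + 1 ≤ n := i.2
  simp [R, DatalogLit.Holds, datOf, comp_pair, this]

theorem holds_pt {i : Fin n} {x : ℕ} :
    (pt i x).Holds I s ↔ (datOf n A).pt (i + 1) (s x) := by
  have : i.1 + 1 ≤ n := i.2
  by_cases h : i.1 = 0
  · simp [pt, h, DatalogLit.Holds, Dat.pt]
  · have h' : 2 ≤ i.1 + 1 := by omega
    simp [pt, h, DatalogLit.Holds, datOf, Dat.pt, comp_single, this, h']

theorem holds_someLit {i : Fin (n + 1)} {x y : ℕ} :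
    (someLit i x y).Holds I s ↔ I (.some i) ![s x, s y] :=
  iff_of_eq (congrArg (I (.some i)) (comp_pair s x y))

theorem holds_succLit {i : Fin n} {x y : ℕ} :
    (succLit i x y).Holds I s ↔ I (.succ i) ![s x, s y] :=
  iff_of_eq (congrArg (I (.succ i)) (comp_pair s x y))

theorem holds_pathLit {i : Fin n} {x y : ℕ} :
    (pathLit i x y).Holds I s ↔ I (.path i) ![s x, s y] :=
  iff_of_eq (congrArg (I (.path i)) (comp_pair s x y))

theorem holds_eq {x y : ℕ} :
    (DatalogLit.eq x y : Lit n).Holds I s ↔ s x = s y := Iff.rfl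

theorem holds_neq {x y : ℕ} :
    (DatalogLit.neq x y : Lit n).Holds I s ↔ s x ≠ s y := Iff.rfl

theorem intended_of_mem_rules {ρ : Rule n} (hρ : ρ ∈ rules n) (s : ℕ → A)
    (hb : ∀ l ∈ ρ.body, l.Holds (intended A) s) : intended A ρ.head (s ∘ ρ.headVars) := by
  simp only [rules, List.mem_append, List.mem_flatMap, List.mem_finRange, true_and] at hρ
  rcases hρ with hρ | ⟨i, hρ⟩
  · simp only [goalRules, List.mem_cons, List.not_mem_nil, or_false] at hρ
    rcases hρ with rfl | rfl | rfl | rfl | rfl | rfl <;>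
      simp only [List.forall_mem_cons, List.not_mem_nil, false_imp_iff, implies_true, and_true,
        holds_le, holds_notLe, holds_someLit, holds_neq] at hb
    · exact Or.inl fun h => hb (h.refl _)
    · exact Or.inl fun h => hb.2.2 (h.antisymm _ _ hb.1 hb.2.1)
    · exact Or.inl fun h => hb.2.2 (h.trans _ _ _ hb.1 hb.2.1)
    · exact Or.inl fun h => (h.total _ _).elim hb.1 hb.2
    · exact Or.inr (Dat.SomeTotal.mono _ (Set.subset_univ _) hb)
    · trivial
  · simp only [levelRules, List.mem_append, List.mem_cons, List.not_mem_nil, or_false] at hρ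
    rcases hρ with (rfl | rfl | rfl | rfl | rfl) | hρ
    all_goals try
      simp only [List.forall_mem_cons, List.not_mem_nil, false_imp_iff, implies_true, and_true,
        holds_le, holds_notLe, holds_someLit, holds_succLit, holds_pathLit, holds_S, holds_R,
        holds_pt, holds_neq] at hb
    · exact hb
    · exact .single hb
    · exact .tail hb.1 hb.2
    · obtain ⟨h1, h2, h3, h4, h5, h6, h7, h8, h9, h10⟩ := hb
      exact Or.inr (Or.inl ⟨_, ⟨h1, h2⟩, _, ⟨h3, h4⟩, h5, _, ⟨h6, h7⟩, h8, h9, h10⟩)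
    · obtain ⟨h1, h2, h3, h4, h5, h6⟩ := hb
      exact Or.inr (Or.inr ⟨_, ⟨h1, h2⟩, _, ⟨h3, h4⟩, h5, h6⟩)
    · split_ifs at hρ with h0
      · simp only [List.mem_cons, List.not_mem_nil, or_false] at hρ
        rcases hρ with rfl | rfl
        all_goals
          simp only [List.forall_mem_cons, List.not_mem_nil, false_imp_iff, implies_true,
            and_true, holds_le, holds_notLe, holds_S, holds_eq, h0] at hb
          obtain ⟨h1, h2, h3, h4, h5, h6⟩ := hb
          refine Or.inl ⟨h0, _, ⟨h1, h2⟩, _, ⟨h3, h4⟩, h5, ?_⟩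
        · exact fun h => h6 h.1
        · exact fun h => h.2 h6
      · simp at hρ

/-- An expansion that satisfies the rules contains the intended interpretation. -/
theorem some_of_rules (hI : ∀ ρ ∈ rules n, ∀ s : ℕ → A,
      (∀ l ∈ ρ.body, l.Holds I s) → I ρ.head (s ∘ ρ.headVars)) (i : ℕ) (hi : i < n + 1) (a b : A)
    (hT : (datOf n A).SomeTotal (datOf n A).path i ((datOf n A).Icc a b)) :
    I (.some ⟨i, hi⟩) ![a, b] := by
  induction i generalizing a b with
  | zero =>
    have := hI ⟨.some 0, ![0, 1], []⟩ (by simp [rules, goalRules])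
      (fun j => [a, b].getD j a) (by simp)
    rw [comp_pair] at this
    exact this
  | succ i ih =>
    let k : Fin n := ⟨i, by omega⟩
    have hmem : ∀ ρ ∈ levelRules k, ρ ∈ rules n := fun ρ hρ =>
      List.mem_append_right _ (List.mem_flatMap.2 ⟨k, List.mem_finRange _, hρ⟩)
    have hs : ∀ x y, (datOf n A).succRel (i + 1) ((datOf n A).SomeTotal (datOf n A).path i) x y →
        I (.succ k) ![x, y] := by
      intro x y h
      have := hI ⟨.succ k, ![0, 1], [pt k 0, pt k 1, S k 0 1, le 0 1, someLit k.castSucc 0 1]⟩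
        (hmem _ (by simp [levelRules])) (fun j => [x, y].getD j x) (by
          simp only [List.forall_mem_cons, List.not_mem_nil, false_imp_iff, implies_true, and_true,
            holds_le, holds_someLit, holds_S, holds_pt]
          exact ⟨h.1, h.2.1, h.2.2.1, h.2.2.2.1, ih (by omega) _ _ h.2.2.2.2⟩)
      rw [comp_pair] at this
      exact this
    have hp : ∀ x y, (datOf n A).path (i + 1)
        ((datOf n A).succRel (i + 1) ((datOf n A).SomeTotal (datOf n A).path i)) x y →
        I (.path k) ![x, y] := by
      intro x y h
      induction h with
      | @single y h =>
        have := hI ⟨.path k, ![0, 1], [succLit k 0 1, le 0 1, .neq 0 1]⟩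
          (hmem _ (by simp [levelRules])) (fun j => [x, y].getD j x) (by
            simp only [List.forall_mem_cons, List.not_mem_nil, false_imp_iff, implies_true,
              and_true, holds_le, holds_succLit, holds_neq]
            exact ⟨hs _ _ h.1, h.2⟩)
        rw [comp_pair] at this
        exact this
      | @tail y z _ h ih' =>
        have := hI ⟨.path k, ![0, 2], [pathLit k 0 1, succLit k 1 2, le 1 2, .neq 1 2]⟩
          (hmem _ (by simp [levelRules])) (fun j => [x, y, z].getD j x) (by
            simp only [List.forall_mem_cons, List.not_mem_nil, false_imp_iff, implies_true,
              and_true, holds_le, holds_succLit, holds_pathLit, holds_neq]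
            exact ⟨ih', hs _ _ h.1, h.2⟩)
        rw [comp_pair] at this
        exact this
    rw [Dat.someTotal_succ] at hT
    rcases hT with ⟨h0, x, hx, y, hy, h1, h2⟩ | ⟨x, hx, y, hy, h1, z, hz, h2, h3, h4⟩ |
      ⟨x, hx, y, hy, h1, h2⟩
    · by_cases hxy : x = y
      · have := hI ⟨.some k.succ, ![0, 1],
            [le 0 2, le 2 1, le 0 3, le 3 1, S k 2 3, .eq 2 3]⟩
          (hmem _ (by simp [levelRules, k, h0])) (fun j => [a, b, x, y].getD j a) (by
            simp only [List.forall_mem_cons, List.not_mem_nil, false_imp_iff, implies_true,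
              and_true, holds_le, holds_S, holds_eq]
            subst h0
            exact ⟨hx.1, hx.2, hy.1, hy.2, h1, hxy⟩)
        rw [comp_pair] at this
        exact this
      · have := hI ⟨.some k.succ, ![0, 1],
            [le 0 2, le 2 1, le 0 3, le 3 1, S k 2 3, notLe 2 3]⟩
          (hmem _ (by simp [levelRules, k, h0])) (fun j => [a, b, x, y].getD j a) (by
            simp only [List.forall_mem_cons, List.not_mem_nil, false_imp_iff, implies_true,
              and_true, holds_le, holds_S, holds_notLe]
            subst h0
            exact ⟨hx.1, hx.2, hy.1, hy.2, h1, fun h => h2 ⟨h, hxy⟩⟩)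
        rw [comp_pair] at this
        exact this
    · have := hI ⟨.some k.succ, ![0, 1], [le 0 2, le 2 1, le 0 3, le 3 1, succLit k 2 3,
            le 0 4, le 4 1, pt k 4, notLe 4 2, notLe 3 4]⟩
        (hmem _ (by simp [levelRules])) (fun j => [a, b, x, y, z].getD j a) (by
          simp only [List.forall_mem_cons, List.not_mem_nil, false_imp_iff, implies_true,
            and_true, holds_le, holds_succLit, holds_pt, holds_notLe]
          exact ⟨hx.1, hx.2, hy.1, hy.2, hs _ _ h1, hz.1, hz.2, h2, h3, h4⟩)
      rw [comp_pair] at this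
      exact this
    · have := hI ⟨.some k.succ, ![0, 1],
          [le 0 2, le 2 1, le 0 3, le 3 1, R k 2 3, pathLit k 2 3]⟩
        (hmem _ (by simp [levelRules])) (fun j => [a, b, x, y].getD j a) (by
          simp only [List.forall_mem_cons, List.not_mem_nil, false_imp_iff, implies_true,
            and_true, holds_le, holds_pathLit, holds_R]
          exact ⟨hx.1, hx.2, hy.1, hy.2, h1, hp _ _ h2⟩)
      rw [comp_pair] at this
      exact this

end SomeTotalIdb

theorem Dat.IsLO.exists_univ_eq_Icc {A : Type} {d : Dat A} (h : d.IsLO) [Finite A] [Nonempty A] :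
    ∃ a b, Set.univ = d.Icc a b := by
  have h1 : ∃ a, ∀ x, d.le a x := by
    have : IsTrans A fun x y => d.lt x y := ⟨fun _ _ _ h1 h2 => h.lt_trans h1 h2⟩
    have : Std.Irrefl fun x y : A => d.lt x y := ⟨fun _ h1 => h1.2 rfl⟩
    obtain ⟨a, _, ha⟩ := (Finite.wellFounded_of_trans_of_irrefl
      fun x y : A => d.lt x y).has_min Set.univ Set.univ_nonempty
    exact ⟨a, fun x => h.not_lt.1 (ha x trivial)⟩
  have h2 : ∃ b, ∀ x, d.le x b := by
    obtain ⟨b, _, hb⟩ := h.wf.has_min Set.univ Set.univ_nonempty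
    exact ⟨b, fun x => h.not_lt.1 (hb x trivial)⟩
  obtain ⟨a, ha⟩ := h1
  obtain ⟨b, hb⟩ := h2
  exact ⟨a, b, (Set.eq_univ_of_forall fun x => (⟨ha x, hb x⟩ : x ∈ d.Icc a b)).symm⟩

theorem SomeTotalIdb.goal_of_rules {n : ℕ} {A : Type} [(sigmaLang n).Structure A] [Finite A]
    [Nonempty A] {I : ∀ i : SomeTotalIdb n, (Fin (arity i) → A) → Prop}
    (hI : ∀ ρ ∈ rules n, ∀ s : ℕ → A, (∀ l ∈ ρ.body, l.Holds I s) → I ρ.head (s ∘ ρ.headVars))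
    (h : ¬ (datOf n A).IsLO ∨ (datOf n A).SomeTotal (datOf n A).path n Set.univ) :
    I .goal ![] := by
  have hgoal : ∀ (l : List (Lit n)), (⟨.goal, ![], l⟩ : Rule n) ∈ goalRules n → ∀ s : ℕ → A,
      (∀ x ∈ l, x.Holds I s) → I .goal ![] := by
    intro l hl s hb
    have := hI _ (List.mem_append_left _ hl) s hb
    exact (congrArg (I .goal) (Subsingleton.elim (s ∘ ![] : Fin 0 → A) ![])).mp this
  by_cases hLO : (datOf n A).IsLO
  · have hT := h.resolve_left (not_not.2 hLO)
    obtain ⟨a, b, hab⟩ := hLO.exists_univ_eq_Icc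
    rw [hab] at hT
    refine hgoal [someLit (Fin.last n) 0 1] (by simp [goalRules])
      (fun j => [a, b].getD j a) ?_
    simp only [List.forall_mem_cons, List.not_mem_nil, false_imp_iff, implies_true, and_true,
      holds_someLit]
    exact some_of_rules hI n _ a b hT
  · rw [Dat.isLO_iff] at hLO
    by_cases h1 : ∀ x, (datOf n A).le x x
    · by_cases h2 : ∀ x y, (datOf n A).le x y → (datOf n A).le y x → x = y
      · by_cases h3 : ∀ x y z, (datOf n A).le x y → (datOf n A).le y z → (datOf n A).le x z
        · have h4 : ¬ ∀ x y, (datOf n A).le x y ∨ (datOf n A).le y x :=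
            fun h4 => hLO ⟨h1, h2, h3, h4⟩
          push Not at h4
          obtain ⟨x, y, h4, h5⟩ := h4
          refine hgoal [notLe 0 1, notLe 1 0] (by simp [goalRules])
            (fun j => [x, y].getD j x) ?_
          simpa [holds_notLe] using ⟨h4, h5⟩
        · push Not at h3
          obtain ⟨x, y, z, h3, h4, h5⟩ := h3
          refine hgoal [le 0 1, le 1 2, notLe 0 2] (by simp [goalRules])
            (fun j => [x, y, z].getD j x) ?_
          simpa [holds_notLe, holds_le] using ⟨h3, h4, h5⟩
      · push Not at h2
        obtain ⟨x, y, h3, h4, h5⟩ := h2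
        refine hgoal [le 0 1, le 1 0, .neq 0 1] (by simp [goalRules])
          (fun j => [x, y].getD j x) ?_
        simpa [holds_neq, holds_le] using ⟨h3, h4, h5⟩
    · push Not at h1
      obtain ⟨x, h1⟩ := h1
      refine hgoal [notLe 0 0] (by simp [goalRules]) (fun j => [x].getD j x) ?_
      simpa [holds_notLe] using h1

theorem SomeTotalIdb.accepts_iff {n : ℕ} {A : Type} [(sigmaLang n).Structure A] [Finite A]
    [Nonempty A] : (SomeTotalIdb.program n).Accepts A ↔
      ¬ (datOf n A).IsLO ∨ (datOf n A).SomeTotal (datOf n A).path n Set.univ := by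
  constructor
  · intro h
    exact h (intended A) fun ρ hρ s hb => intended_of_mem_rules hρ s hb
  · intro h I hI
    have hg := goal_of_rules (I := I) hI h
    rwa [Subsingleton.elim (![] : Fin 0 → A)] at hg

theorem ETCFormula.realize_notLinear_or {n : ℕ} {A : Type} [(sigmaLang n).Structure A] [Finite A]
    [Nonempty A] :
    (notLinear.or (.ex <| .ex <| someTotal (n := n) (m := 2) n 0 1)).Realize
      (Fin.elim0 : Fin 0 → A) ↔
      ¬ (datOf n A).IsLO ∨ (datOf n A).SomeTotal (datOf n A).path n Set.univ := by
  simp only [Realize, realize_notLinear, realize_someTotal]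
  by_cases hLO : (datOf n A).IsLO
  · simp only [hLO, not_true, false_or]
    constructor
    · rintro ⟨a, b, h⟩
      exact h.mono _ (Set.subset_univ _)
    · intro h
      obtain ⟨a, b, hab⟩ := hLO.exists_univ_eq_Icc
      exact ⟨a, b, hab ▸ h⟩
  · simp [hLO]

/-! ### Marked structures and their concatenation -/

/-- A structure with two unary marks and a truth value. The marks are the places at which
concatenation creates pairs of `S_l`: from the `top` elements of the left factor to the `bot`
elements of the right factor. Marks are visible through a factor iff it is `transparent`. -/
structure Marked : Type 1 where
  carrier : Type
  dat : Dat carrier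
  bot : carrier → Prop
  top : carrier → Prop
  transparent : Prop

namespace Marked

instance : CoeSort Marked Type := ⟨Marked.carrier⟩

/-- The concatenation at level `l`. It is associative up to isomorphism, because the marks of the
outer factors meet exactly when everything between them is transparent. -/
def cat (l : ℕ) (X Y : Marked) : Marked where
  carrier := X ⊕ Y
  dat :=
    { le := fun
        | .inl x, .inl x' => X.dat.le x x'
        | .inr y, .inr y' => Y.dat.le y y'
        | .inl _, .inr _ => True
        | .inr _, .inl _ => False
      S := fun i => fun
        | .inl x, .inl x' => X.dat.S i x x'
        | .inr y, .inr y' => Y.dat.S i y y'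
        | .inl x, .inr y => i = l ∧ X.top x ∧ Y.bot y
        | .inr _, .inl _ => False
      R := fun i => fun
        | .inl x, .inl x' => X.dat.R i x x'
        | .inr y, .inr y' => Y.dat.R i y y'
        | _, _ => False
      P := fun i => Sum.elim (X.dat.P i) (Y.dat.P i) }
  bot := Sum.elim X.bot fun y => X.transparent ∧ Y.bot y
  top := Sum.elim (fun x => Y.transparent ∧ X.top x) Y.top
  transparent := X.transparent ∧ Y.transparent

/-- The empty structure that is neutral for concatenation. -/
def unit : Marked where
  carrier := Empty
  dat := ⟨fun _ _ => True, fun _ _ _ => True, fun _ _ _ => True, fun _ _ => True⟩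
  bot _ := True
  top _ := True
  transparent := True

/-- The `a`-fold concatenation of a marked structure with itself. -/
def pow (l : ℕ) (X : Marked) : ℕ → Marked
  | 0 => unit
  | a + 1 => cat l X (pow l X a)

/-- Add the pairs from `bot` to `top` to `R_l` and forget the marks. -/
def close (l : ℕ) (X : Marked) : Marked where
  carrier := X
  dat := { X.dat with R := fun i x y => X.dat.R i x y ∨ (i = l ∧ X.bot x ∧ X.top y) }
  bot _ := False
  top _ := False
  transparent := True

/-! ### The alternating game -/

/-- The correspondence `E` is a partial isomorphism. -/
structure PartialIso (X Y : Marked) (E : X → Y → Prop) : Prop where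
  transparent : X.transparent ↔ Y.transparent
  eq : ∀ {x y x' y'}, E x y → E x' y' → (x = x' ↔ y = y')
  le : ∀ {x y x' y'}, E x y → E x' y' → (X.dat.le x x' ↔ Y.dat.le y y')
  S : ∀ i {x y x' y'}, E x y → E x' y' → (X.dat.S i x x' ↔ Y.dat.S i y y')
  R : ∀ i {x y x' y'}, E x y → E x' y' → (X.dat.R i x x' ↔ Y.dat.R i y y')
  P : ∀ i {x y}, E x y → (X.dat.P i x ↔ Y.dat.P i y)
  bot : ∀ {x y}, E x y → (X.bot x ↔ Y.bot y)
  top : ∀ {x y}, E x y → (X.top x ↔ Y.top y)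

/-- One round of the game: Spoiler picks at most `j` elements of `X`, Duplicator extends the
correspondence `E` to them, and the game `G` goes on with the roles of `X` and `Y` exchanged. -/
def Round (j : ℕ) (G : ∀ X Y : Marked, (X → Y → Prop) → Prop) (X Y : Marked) (E : X → Y → Prop) :
    Prop :=
  ∀ C : Finset X, C.card ≤ j → ∃ E' : X → Y → Prop,
    (∀ x y, E x y → E' x y) ∧ (∀ x ∈ C, ∃ y, E' x y) ∧ G Y X (fun y x => E' x y)

/-- Duplicator wins the game of `m` rounds with at most `k` picks each, where Spoiler starts in `X`
and changes sides after each round. -/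
def Sim (k : ℕ) : ℕ → ∀ X Y : Marked, (X → Y → Prop) → Prop
  | 0 => PartialIso
  | m + 1 => Round k (Sim k m)

/-- The empty correspondence. -/
abbrev noRel (X Y : Marked) : X → Y → Prop := fun _ _ => False

variable {X Y Z X' Y' Z' : Marked} {k m j l : ℕ} {E : X → Y → Prop}

theorem PartialIso.mono {E' : X → Y → Prop} (h : PartialIso X Y E') (hE : ∀ x y, E x y → E' x y) :
    PartialIso X Y E where
  transparent := h.transparent
  eq h1 h2 := h.eq (hE _ _ h1) (hE _ _ h2)
  le h1 h2 := h.le (hE _ _ h1) (hE _ _ h2)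
  S i _ _ _ _ h1 h2 := h.S i (hE _ _ h1) (hE _ _ h2)
  R i _ _ _ _ h1 h2 := h.R i (hE _ _ h1) (hE _ _ h2)
  P i _ _ h1 := h.P i (hE _ _ h1)
  bot h1 := h.bot (hE _ _ h1)
  top h1 := h.top (hE _ _ h1)

theorem PartialIso.swap (h : PartialIso X Y E) : PartialIso Y X fun y x => E x y where
  transparent := h.transparent.symm
  eq h1 h2 := (h.eq h1 h2).symm
  le h1 h2 := (h.le h1 h2).symm
  S i _ _ _ _ h1 h2 := (h.S i h1 h2).symm
  R i _ _ _ _ h1 h2 := (h.R i h1 h2).symm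
  P i _ _ h1 := (h.P i h1).symm
  bot h1 := (h.bot h1).symm
  top h1 := (h.top h1).symm

theorem PartialIso.trans {F : Y → Z → Prop} (h : PartialIso X Y E) (h' : PartialIso Y Z F) :
    PartialIso X Z fun x z => ∃ y, E x y ∧ F y z where
  transparent := h.transparent.trans h'.transparent
  eq := fun ⟨_, h1, h2⟩ ⟨_, h3, h4⟩ => (h.eq h1 h3).trans (h'.eq h2 h4)
  le := fun ⟨_, h1, h2⟩ ⟨_, h3, h4⟩ => (h.le h1 h3).trans (h'.le h2 h4)
  S := fun i _ _ _ _ ⟨_, h1, h2⟩ ⟨_, h3, h4⟩ => (h.S i h1 h3).trans (h'.S i h2 h4)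
  R := fun i _ _ _ _ ⟨_, h1, h2⟩ ⟨_, h3, h4⟩ => (h.R i h1 h3).trans (h'.R i h2 h4)
  P := fun i _ _ ⟨_, h1, h2⟩ => (h.P i h1).trans (h'.P i h2)
  bot := fun ⟨_, h1, h2⟩ => (h.bot h1).trans (h'.bot h2)
  top := fun ⟨_, h1, h2⟩ => (h.top h1).trans (h'.top h2)

theorem PartialIso.cat {F : X' → Y' → Prop} (h : PartialIso X Y E) (h' : PartialIso X' Y' F) :
    PartialIso (cat l X X') (cat l Y Y') (Sum.LiftRel E F) where
  transparent := and_congr h.transparent h'.transparent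
  eq := by
    rintro _ _ _ _ (h1 | h1) (h2 | h2)
    · exact Sum.inl_injective.eq_iff.trans ((h.eq h1 h2).trans Sum.inl_injective.eq_iff.symm)
    · exact ⟨fun h => (Sum.inl_ne_inr h).elim, fun h => (Sum.inl_ne_inr h).elim⟩
    · exact ⟨fun h => (Sum.inr_ne_inl h).elim, fun h => (Sum.inr_ne_inl h).elim⟩
    · exact Sum.inr_injective.eq_iff.trans ((h'.eq h1 h2).trans Sum.inr_injective.eq_iff.symm)
  le := by
    rintro _ _ _ _ (h1 | h1) (h2 | h2)
    exacts [h.le h1 h2, Iff.rfl, Iff.rfl, h'.le h1 h2]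
  S := by
    rintro i _ _ _ _ (h1 | h1) (h2 | h2)
    exacts [h.S i h1 h2, and_congr_right fun _ => and_congr (h.top h1) (h'.bot h2), Iff.rfl,
      h'.S i h1 h2]
  R := by
    rintro i _ _ _ _ (h1 | h1) (h2 | h2)
    exacts [h.R i h1 h2, Iff.rfl, Iff.rfl, h'.R i h1 h2]
  P := by
    rintro i _ _ (h1 | h1)
    exacts [h.P i h1, h'.P i h1]
  bot := by
    rintro _ _ (h1 | h1)
    exacts [h.bot h1, and_congr h.transparent (h'.bot h1)]
  top := by
    rintro _ _ (h1 | h1)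
    exacts [and_congr h'.transparent (h.top h1), h'.top h1]

theorem PartialIso.close (h : PartialIso X Y E) : PartialIso (close l X) (close l Y) E where
  transparent := Iff.rfl
  eq := h.eq
  le := h.le
  S := h.S
  R i _ _ _ _ h1 h2 := or_congr (h.R i h1 h2) (and_congr_right fun _ =>
    and_congr (h.bot h1) (h.top h2))
  P := h.P
  bot _ := Iff.rfl
  top _ := Iff.rfl

theorem Sim.mono {E' : X → Y → Prop} (h : Sim k m X Y E') (hE : ∀ x y, E x y → E' x y) :
    Sim k m X Y E := by
  cases m with
  | zero => exact PartialIso.mono h hE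
  | succ m =>
    intro C hC
    obtain ⟨E'', h1, h2⟩ := h C hC
    exact ⟨E'', fun x y hxy => h1 x y (hE x y hxy), h2⟩

theorem Sim.partialIso (h : Sim k m X Y E) : PartialIso X Y E := by
  induction m generalizing X Y with
  | zero => exact h
  | succ m ih =>
    obtain ⟨E', h1, _, h3⟩ := h ∅ (Nat.zero_le _)
    exact (ih h3).swap.mono h1

theorem Sim.trans {F : Y → Z → Prop} (h : Sim k m X Y E) (h' : Sim k m Y Z F) :
    Sim k m X Z fun x z => ∃ y, E x y ∧ F y z := by
  induction m generalizing X Y Z with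
  | zero => exact PartialIso.trans h h'
  | succ m ih =>
    intro C hC
    obtain ⟨E', h1, h2, h3⟩ := h C hC
    choose g hg using h2
    have := Classical.decEq Y
    let D : Finset Y := C.attach.image fun x : {x // x ∈ C} => g x.1 x.2
    obtain ⟨F', h4, h5, h6⟩ := h' D (Finset.card_image_le.trans (C.card_attach.trans_le hC))
    refine ⟨fun x z => ∃ y, E' x y ∧ F' y z,
      fun x z ⟨y, hy, hz⟩ => ⟨y, h1 _ _ hy, h4 _ _ hz⟩, fun x hx => ?_,
      (ih h6 h3).mono fun z x ⟨y, hy, hz⟩ => ⟨y, hz, hy⟩⟩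
    obtain ⟨z, hz⟩ := h5 (g x hx) (Finset.mem_image.2 ⟨⟨x, hx⟩, Finset.mem_attach _ _, rfl⟩)
    exact ⟨z, g x hx, hg x hx, hz⟩

theorem Sim.trans_noRel (h : Sim k m X Y (noRel X Y)) (h' : Sim k m Y Z (noRel Y Z)) :
    Sim k m X Z (noRel X Z) :=
  (h.trans h').mono fun _ _ h => h.elim

theorem Sim.cat {F : X' → Y' → Prop} (h : Sim k m X Y E) (h' : Sim k m X' Y' F) :
    Sim k m (cat l X X') (cat l Y Y') (Sum.LiftRel E F) := by
  induction m generalizing X Y X' Y' with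
  | zero => exact PartialIso.cat h h'
  | succ m ih =>
    intro C hC
    let D : Finset (X ⊕ X') := C
    have hD : D.toLeft.card + D.toRight.card = C.card := D.card_toLeft_add_card_toRight
    obtain ⟨E', h1, h2, h3⟩ := h D.toLeft (by omega)
    obtain ⟨F', h4, h5, h6⟩ := h' D.toRight (by omega)
    refine ⟨Sum.LiftRel E' F', fun x y hxy => hxy.mono h1 h4, ?_, (ih h3 h6).mono ?_⟩
    · rintro (x | x) hx
      · obtain ⟨y, hy⟩ := h2 x (Finset.mem_toLeft.2 hx)
        exact ⟨.inl y, .inl hy⟩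
      · obtain ⟨y, hy⟩ := h5 x (Finset.mem_toRight.2 hx)
        exact ⟨.inr y, .inr hy⟩
    · rintro _ _ (h | h)
      exacts [.inl h, .inr h]

theorem Sim.cat_noRel (h : Sim k m X Y (noRel X Y)) (h' : Sim k m X' Y' (noRel X' Y')) :
    Sim k m (Marked.cat l X X') (Marked.cat l Y Y') (noRel _ _) :=
  (h.cat h').mono fun _ _ h => h.elim

theorem Sim.close (h : Sim k m X Y E) : Sim k m (close l X) (close l Y) E := by
  induction m generalizing X Y with
  | zero => exact PartialIso.close h
  | succ m ih =>
    intro C hC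
    obtain ⟨E', h1, h2, h3⟩ := h C hC
    exact ⟨E', h1, h2, ih h3⟩

/-! ### Isomorphisms of marked structures -/

/-- `f` preserves all the symbols, the marks and the transparency. -/
def IsIso (X Y : Marked) (f : X ≃ Y) : Prop := PartialIso X Y fun x y => f x = y

/-- The marked structures are isomorphic. -/
def Isom (X Y : Marked) : Prop := ∃ f : X ≃ Y, IsIso X Y f

theorem IsIso.symm {f : X ≃ Y} (h : IsIso X Y f) : IsIso Y X f.symm :=
  PartialIso.mono (PartialIso.swap h) fun _ _ h => (f.symm_apply_eq.1 h).symm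

theorem IsIso.trans {f : X ≃ Y} {g : Y ≃ Z} (h : IsIso X Y f) (h' : IsIso Y Z g) :
    IsIso X Z (f.trans g) :=
  PartialIso.mono (PartialIso.trans h h') fun _ _ h => ⟨_, rfl, h⟩

theorem IsIso.refl : IsIso X X (Equiv.refl X) := by
  constructor <;> intros <;> subst_vars <;> rfl

theorem IsIso.cat {f : X ≃ Y} {g : X' ≃ Y'} (h : IsIso X Y f) (h' : IsIso X' Y' g) :
    IsIso (cat l X X') (cat l Y Y') (Equiv.sumCongr f g) :=
  PartialIso.mono (PartialIso.cat h h') fun x y hxy => by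
    subst hxy
    cases x
    exacts [.inl rfl, .inr rfl]

theorem isIso_assoc : IsIso (cat l (cat l X Y) Z) (cat l X (cat l Y Z)) (Equiv.sumAssoc X Y Z) := by
  constructor
  · exact and_assoc
  · rintro x _ x' _ rfl rfl
    exact (Equiv.sumAssoc X Y Z).injective.eq_iff.symm
  · rintro ((x | x) | x) _ ((x' | x') | x') _ rfl rfl <;> rfl
  · rintro i ((x | x) | x) _ ((x' | x') | x') _ rfl rfl
    exacts [Iff.rfl, Iff.rfl, and_congr_right fun _ =>
      ⟨fun h => ⟨h.1.2, h.1.1, h.2⟩, fun h => ⟨⟨h.2.1, h.1⟩, h.2.2⟩⟩, Iff.rfl, Iff.rfl, Iff.rfl,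
      Iff.rfl, Iff.rfl, Iff.rfl]
  · rintro i ((x | x) | x) _ ((x' | x') | x') _ rfl rfl <;> rfl
  · rintro i ((x | x) | x) _ rfl <;> rfl
  · rintro ((x | x) | x) _ rfl
    exacts [Iff.rfl, Iff.rfl, and_assoc]
  · rintro ((x | x) | x) _ rfl
    exacts [⟨fun h => ⟨⟨h.2.1, h.1⟩, h.2.2⟩, fun h => ⟨h.1.2, h.1.1, h.2⟩⟩, Iff.rfl, Iff.rfl]

theorem isIso_unit : IsIso X (cat l unit X) (Equiv.emptySum Empty X).symm := by
  constructor
  · exact (iff_of_eq (true_and _)).symm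
  · rintro x _ x' _ rfl rfl
    exact (Equiv.emptySum Empty X).symm.injective.eq_iff.symm
  · rintro x _ x' _ rfl rfl; rfl
  · rintro i x _ x' _ rfl rfl; rfl
  · rintro i x _ x' _ rfl rfl; rfl
  · rintro i x _ rfl; rfl
  · rintro x _ rfl; exact (iff_of_eq (true_and _)).symm
  · rintro x _ rfl; rfl

theorem Isom.refl (X : Marked) : Isom X X := ⟨_, IsIso.refl⟩

theorem Isom.symm (h : Isom X Y) : Isom Y X := ⟨_, h.choose_spec.symm⟩

theorem Isom.trans (h : Isom X Y) (h' : Isom Y Z) : Isom X Z :=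
  ⟨_, h.choose_spec.trans h'.choose_spec⟩

theorem Isom.cat (h : Isom X Y) (h' : Isom X' Y') : Isom (cat l X X') (cat l Y Y') :=
  ⟨_, h.choose_spec.cat h'.choose_spec⟩

theorem isom_assoc : Isom (cat l (cat l X Y) Z) (cat l X (cat l Y Z)) := ⟨_, isIso_assoc⟩

theorem isom_pow_add (a b : ℕ) : Isom (pow l X (a + b)) (cat l (pow l X a) (pow l X b)) := by
  induction a with
  | zero =>
    rw [Nat.zero_add]
    exact ⟨_, isIso_unit⟩
  | succ a ih =>
    rw [Nat.succ_add]
    exact ((Isom.refl X).cat ih).trans isom_assoc.symm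

theorem IsIso.sim {f : X ≃ Y} (h : IsIso X Y f) : Sim k m X Y fun x y => f x = y := by
  induction m generalizing X Y with
  | zero => exact h
  | succ m ih =>
    exact fun C _ => ⟨_, fun _ _ h => h, fun x _ => ⟨_, rfl⟩,
      (ih h.symm).mono fun y x hxy => by rw [← hxy, f.symm_apply_apply]⟩

theorem Isom.round (h : Isom X Y) : Round j (Sim k m) X Y (noRel X Y) := by
  obtain ⟨f, hf⟩ := h
  exact fun C _ => ⟨fun x y => f x = y, fun _ _ h => h.elim, fun x _ => ⟨_, rfl⟩,
    (hf.symm.sim).mono fun y x hxy => by rw [← hxy, f.symm_apply_apply]⟩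

theorem Isom.sim (h : Isom X Y) : Sim k m X Y (noRel X Y) := by
  obtain ⟨f, hf⟩ := h
  exact hf.sim.mono fun _ _ h => h.elim

/-! ### Powers of a marked structure -/

/-- Every element of a power splits it into two powers and the factor that contains it. -/
theorem exists_split_pow (a : ℕ) (c : pow l X a) : ∃ s t, a = s + 1 + t ∧
    ∃ f : pow l X a ≃ cat l (pow l X s) (cat l X (pow l X t)),
      IsIso _ _ f ∧ ∃ x : X, f c = .inr (.inl x) := by
  induction a with
  | zero => exact c.elim
  | succ a ih =>
    rcases c with x | c
    · exact ⟨0, a, by omega, _, isIso_unit (X := cat l X (pow l X a)), x, rfl⟩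
    · obtain ⟨s, t, hst, f, hf, x, hx⟩ := ih c
      refine ⟨s + 1, t, by omega, _, (IsIso.refl.cat hf).trans isIso_assoc.symm, x, ?_⟩
      change (Equiv.sumAssoc _ _ _).symm (Sum.inr (f c)) = _
      rw [hx]
      rfl

/-- A round with one more pick: after any first pick, it suffices to answer `j` picks on each side
of a factor that contains the first pick and occurs unchanged in the other structure. -/
theorem round_succ {W W' : Marked} (h0 : Round j (Sim k m) W W' (noRel W W'))
    (h : ∀ c : W, ∃ (X Z X' Y Y' : Marked) (f : W ≃ Marked.cat l X (Marked.cat l Z X')),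
      IsIso _ _ f ∧ (∃ z : Z, f c = .inr (.inl z)) ∧
      Isom (Marked.cat l Y (Marked.cat l Z Y')) W' ∧
      Round j (Sim k m) X Y (noRel X Y) ∧ Round j (Sim k m) X' Y' (noRel X' Y')) :
    Round (j + 1) (Sim k m) W W' (noRel W W') := by
  intro C hC
  rcases C.eq_empty_or_nonempty with rfl | ⟨c, hc⟩
  · exact h0 ∅ (Nat.zero_le _)
  obtain ⟨X, Z, X', Y, Y', f, hf, ⟨z, hz⟩, ⟨g, hg⟩, h1, h2⟩ := h c
  let f' : W ≃ X ⊕ (Z ⊕ X') := f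
  let D : Finset (X ⊕ (Z ⊕ X')) := C.map f'.toEmbedding
  have hD : D.toLeft.card + D.toRight.card = C.card :=
    D.card_toLeft_add_card_toRight.trans (Finset.card_map _)
  have hD' := D.toRight.card_toLeft_add_card_toRight
  have hpos : 0 < D.toRight.toLeft.card := by
    refine Finset.card_pos.2 ⟨z, ?_⟩
    rw [Finset.mem_toLeft, Finset.mem_toRight]
    exact Finset.mem_map.2 ⟨c, hc, hz⟩
  obtain ⟨E, _, hE, hE'⟩ := h1 D.toLeft (by omega)
  obtain ⟨F, _, hF, hF'⟩ := h2 D.toRight.toRight (by omega)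
  have hs : Sim k m (Marked.cat l Y (Marked.cat l Z Y')) (Marked.cat l X (Marked.cat l Z X')) _ :=
    hE'.cat ((IsIso.refl (X := Z)).sim.cat hF')
  have hcov : ∀ x ∈ D, ∃ y, Sum.LiftRel (fun y x => E x y)
      (Sum.LiftRel (fun x y => Equiv.refl Z x = y) fun y x => F x y) y x := by
    rintro (x | x | x) hx
    · obtain ⟨y, hy⟩ := hE x (Finset.mem_toLeft.2 hx)
      exact ⟨_, .inl hy⟩
    · exact ⟨_, .inr (.inl (c := x) rfl)⟩
    · obtain ⟨y, hy⟩ := hF x (Finset.mem_toRight.2 (Finset.mem_toRight.2 hx))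
      exact ⟨_, .inr (.inr hy)⟩
  have hs' := (hg.symm.sim.trans hs).trans hf.symm.sim
  refine ⟨fun x y => _, fun _ _ h => h.elim, ?_, hs'⟩
  intro x hx
  obtain ⟨y, hy⟩ := hcov (f' x) (Finset.mem_map_of_mem _ hx)
  exact ⟨g y, f x, ⟨y, g.symm_apply_apply y, hy⟩, f.symm_apply_apply x⟩

/-- Large powers cannot be told apart. -/
theorem exists_sim_pow (k l m : ℕ) (Y : Marked) :
    ∃ N, ∀ a b, N ≤ a → N ≤ b → Sim k m (pow l Y a) (pow l Y b) (noRel _ _) := by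
  induction m with
  | zero =>
    have ht : ∀ a, 1 ≤ a → ((pow l Y a).transparent ↔ Y.transparent) := by
      intro a ha
      induction a, ha using Nat.le_induction with
      | base => exact and_iff_left trivial
      | succ a _ ih => exact (and_congr_right fun _ => ih).trans (and_self_iff)
    exact ⟨1, fun a b ha hb => ⟨(ht a ha).trans (ht b hb).symm, fun h => h.elim, fun h => h.elim,
      fun _ _ _ _ _ h => h.elim, fun _ _ _ _ _ h => h.elim, fun _ _ _ h => h.elim,
      fun h => h.elim, fun h => h.elim⟩⟩
  | succ m ih =>
    suffices ∀ j, ∃ N, ∀ a b, N ≤ a → N ≤ b →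
        Round j (Sim k m) (pow l Y a) (pow l Y b) (noRel _ _) from this k
    intro j
    induction j with
    | zero =>
      obtain ⟨N, hN⟩ := ih
      refine ⟨N, fun a b ha hb C hC => ⟨noRel _ _, fun _ _ h => h, ?_, hN b a hb ha⟩⟩
      rw [Nat.le_zero, Finset.card_eq_zero] at hC
      simp [hC]
    | succ j ihj =>
      obtain ⟨N, hN⟩ := ihj
      refine ⟨2 * N + 1, fun a b ha hb => round_succ (l := l) (hN a b (by omega) (by omega))
        fun c => ?_⟩
      obtain ⟨s, t, hst, f, hf, y, hy⟩ := exists_split_pow a c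
      -- A side shorter than `N` is kept, a longer one is only kept longer than `N`.
      obtain ⟨s', t', hb', hs, ht⟩ : ∃ s' t', b = s' + (1 + t') ∧
          (s = s' ∨ N ≤ s ∧ N ≤ s') ∧ (t = t' ∨ N ≤ t ∧ N ≤ t') := by
        by_cases h1 : s < N
        · exact ⟨s, b - s - 1, by omega, by omega, by omega⟩
        · by_cases h2 : t < N
          · exact ⟨b - t - 1, t, by omega, by omega, by omega⟩
          · exact ⟨N, b - N - 1, by omega, by omega, by omega⟩
      have key : ∀ s s', (s = s' ∨ N ≤ s ∧ N ≤ s') →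
          Round j (Sim k m) (pow l Y s) (pow l Y s') (noRel _ _) := by
        rintro s s' (rfl | ⟨h1, h2⟩)
        · exact (Isom.refl _).round
        · exact hN _ _ h1 h2
      refine ⟨_, _, _, pow l Y s', pow l Y t', f, hf, ⟨y, hy⟩, ?_, key _ _ hs, key _ _ ht⟩
      rw [hb', Nat.add_comm 1 t']
      exact (isom_pow_add s' (t' + 1)).symm

/-- If `X` can be replaced by `Y` in `m` rounds, then in `m + 1` rounds a large power of `Y` can be
replaced by one with an additional factor `X` in the middle: Duplicator keeps `X` away from the
first picks of Spoiler, and then mistakes it for one more factor `Y`. -/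
theorem exists_round_insert (l : ℕ) (h : Sim k m X Y (noRel X Y)) :
    ∃ N, ∀ K, N ≤ K → Sim k (m + 1) (pow l Y K) (cat l (pow l Y K) (cat l X (pow l Y K)))
      (noRel _ _) := by
  suffices ∀ j, ∃ N, ∀ a L R, N ≤ a → a ≤ L → a ≤ R →
      Round j (Sim k m) (pow l Y a) (cat l (pow l Y L) (cat l X (pow l Y R))) (noRel _ _) by
    obtain ⟨N, hN⟩ := this k
    exact ⟨N, fun K hK => hN K K K hK le_rfl le_rfl⟩
  intro j
  induction j with
  | zero =>
    obtain ⟨N, hN⟩ := exists_sim_pow k l m Y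
    refine ⟨N, fun a L R ha hL hR C hC => ⟨noRel _ _, fun _ _ h => h, ?_, ?_⟩⟩
    · rw [Nat.le_zero, Finset.card_eq_zero] at hC
      simp [hC]
    · have h1 : Sim k m (Marked.cat l (pow l Y L) (Marked.cat l X (pow l Y R)))
          (Marked.cat l (pow l Y L) (pow l Y (R + 1))) (noRel _ _) :=
        (Isom.refl _).sim.cat_noRel (h.cat_noRel (Isom.refl _).sim)
      exact (h1.trans_noRel (isom_pow_add L (R + 1)).symm.sim).trans_noRel
        (hN _ _ (by omega) (by omega))
  | succ j ihj =>
    obtain ⟨N, hN⟩ := ihj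
    refine ⟨2 * N + 1, fun a L R ha hL hR => round_succ (l := l)
      (hN a L R (by omega) (by omega) (by omega)) fun c => ?_⟩
    obtain ⟨s, t, hst, f, hf, y, hy⟩ := exists_split_pow a c
    by_cases ht : N ≤ t
    · refine ⟨_, _, _, pow l Y s, Marked.cat l (pow l Y (L - s - 1)) (Marked.cat l X (pow l Y R)),
        f, hf, ⟨y, hy⟩, ?_, (Isom.refl _).round, hN _ _ _ ht (by omega) (by omega)⟩
      have h1 := isom_pow_add (l := l) (X := Y) s (L - s - 1 + 1)
      rw [show s + (L - s - 1 + 1) = L by omega] at h1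
      exact ((Isom.refl _).cat isom_assoc.symm).trans
        (isom_assoc.symm.trans (h1.symm.cat (Isom.refl _)))
    · refine ⟨_, _, _, Marked.cat l (pow l Y L) (Marked.cat l X (pow l Y (R - t - 1))), pow l Y t,
        f, hf, ⟨y, hy⟩, ?_, hN _ _ _ (by omega) (by omega) (by omega), (Isom.refl _).round⟩
      have h1 := isom_pow_add (l := l) (X := Y) (R - t - 1) (t + 1)
      rw [show R - t - 1 + (t + 1) = R by omega] at h1
      exact isom_assoc.trans ((Isom.refl _).cat
        (isom_assoc.trans ((Isom.refl _).cat h1.symm)))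

end Marked

/-! ### Transfer of prenex sentences along the game -/

namespace Marked

/-- A marked structure as a structure for `σ_n`; the marks are forgotten. -/
abbrev toStructure (n : ℕ) (X : Marked) : (sigmaLang n).Structure X where
  funMap f := f.elim
  RelMap r v := match r, v with
    | .le, v => X.dat.le (v 0) (v 1)
    | .S i _, v => X.dat.S i (v 0) (v 1)
    | .R i _, v => X.dat.R i (v 0) (v 1)
    | .P i _, v => X.dat.P i (v 0)

/-- Truth of a formula in the structure for `σ_n` that underlies `X`. -/
def Sat {n k : ℕ} (X : Marked) (φ : (sigmaLang n).BoundedFormula Empty k) (v : Fin k → X) : Prop :=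
  letI := X.toStructure n
  φ.Realize default v

theorem PartialIso.sat_iff {n k : ℕ} {X Y : Marked} {E : X → Y → Prop} (h : PartialIso X Y E)
    {φ : (sigmaLang n).BoundedFormula Empty k} (hφ : φ.IsQF) {v : Fin k → X} {w : Fin k → Y}
    (hvw : ∀ i, E (v i) (w i)) : X.Sat φ v ↔ Y.Sat φ w := by
  let := X.toStructure n
  let := Y.toStructure n
  have ht : ∀ t : (sigmaLang n).Term (Empty ⊕ Fin k),
      E (t.realize (Sum.elim default v)) (t.realize (Sum.elim default w)) := by
    rintro ((e | i) | ⟨f, _⟩)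
    · exact e.elim
    · exact hvw i
    · exact Empty.elim f
  unfold Sat
  induction hφ with
  | falsum => rfl
  | of_isAtomic hφ =>
    cases hφ with
    | equal s t =>
      simp only [BoundedFormula.realize_bdEqual]
      exact h.eq (ht s) (ht t)
    | rel r ts =>
      simp only [BoundedFormula.realize_rel]
      cases r with
      | le => exact h.le (ht _) (ht _)
      | S i => exact h.S i (ht _) (ht _)
      | R i => exact h.R i (ht _) (ht _)
      | P i => exact h.P i (ht _)
  | imp _ _ ih1 ih2 =>
    simp only [BoundedFormula.realize_imp]
    exact imp_congr ih1 ih2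

theorem snoc_rel {X Y : Type} {k : ℕ} {E : X → Y → Prop} {v : Fin k → X} {w : Fin k → Y}
    (h : ∀ i, E (v i) (w i)) {x : X} {y : Y} (hxy : E x y) (i : Fin (k + 1)) :
    E ((Fin.snoc v x : Fin (k + 1) → X) i) ((Fin.snoc w y : Fin (k + 1) → Y) i) := by
  refine Fin.lastCases ?_ (fun i => ?_) i
  · simpa using hxy
  · simpa using h i

/-- A true `Σ_m` formula (`b = true`), or a false `Π_m` formula (`b = false`), has boundedly many
witnesses in its first block; once Duplicator has answered them and has a winning strategy for the
remaining `m - 1` rounds, it is true (respectively false) in the other structure as well. -/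
theorem exists_witnesses {n k m : ℕ} {b : Bool} {φ : (sigmaLang n).BoundedFormula Empty k}
    (hφ : PrefixClass b m φ) : ∃ K, ∀ p, K ≤ p → ∀ (X Y : Marked) (v : Fin k → X),
      (X.Sat φ v ↔ b = true) → ∃ C : Finset X, C.card ≤ K ∧ ∀ (E : X → Y → Prop) (w : Fin k → Y),
        (∀ i, E (v i) (w i)) → (∀ x ∈ C, ∃ y, E x y) → Sim p (m - 1) Y X (fun y x => E x y) →
        (Y.Sat φ w ↔ b = true) := by
  induction hφ with
  | qf h =>
    exact ⟨0, fun p _ X Y v hv => ⟨∅, le_rfl, fun E w hE _ hS =>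
      (hS.partialIso.swap.sat_iff h hE).symm.trans hv⟩⟩
  | ex _ ih =>
    obtain ⟨K, hK⟩ := ih
    refine ⟨K + 1, fun p hp X Y v hv => ?_⟩
    let := X.toStructure n
    let := Y.toStructure n
    obtain ⟨a, ha⟩ := BoundedFormula.realize_ex.1 (hv.2 rfl)
    obtain ⟨C, hC, h⟩ := hK p (by omega) X Y (Fin.snoc v a) ⟨fun _ => rfl, fun _ => ha⟩
    have := Classical.decEq X
    refine ⟨insert a C, (Finset.card_insert_le _ _).trans (by omega), fun E w hE hcov hS => ?_⟩
    obtain ⟨y, hy⟩ := hcov a (Finset.mem_insert_self _ _)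
    have h1 := h E (Fin.snoc w y) (snoc_rel hE hy)
      (fun x hx => hcov x (Finset.mem_insert_of_mem hx)) hS
    exact ⟨fun _ => rfl, fun _ => BoundedFormula.realize_ex.2 ⟨y, h1.2 rfl⟩⟩
  | all _ ih =>
    obtain ⟨K, hK⟩ := ih
    refine ⟨K + 1, fun p hp X Y v hv => ?_⟩
    let := X.toStructure n
    let := Y.toStructure n
    have hv' := fun h => Bool.false_ne_true (hv.1 (BoundedFormula.realize_all.2 h))
    obtain ⟨a, ha⟩ := not_forall.1 hv'
    obtain ⟨C, hC, h⟩ := hK p (by omega) X Y (Fin.snoc v a)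
      ⟨fun h => (ha h).elim, fun h => (Bool.false_ne_true h).elim⟩
    have := Classical.decEq X
    refine ⟨insert a C, (Finset.card_insert_le _ _).trans (by omega), fun E w hE hcov hS => ?_⟩
    obtain ⟨y, hy⟩ := hcov a (Finset.mem_insert_self _ _)
    have h1 := h E (Fin.snoc w y) (snoc_rel hE hy)
      (fun x hx => hcov x (Finset.mem_insert_of_mem hx)) hS
    exact ⟨fun h2 => h1.1 (BoundedFormula.realize_all.1 h2 y),
      fun h => (Bool.false_ne_true h).elim⟩
  | @alternate b m k φ hφ ih =>
    obtain ⟨K, hK⟩ := ih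
    refine ⟨K, fun p hp X Y v hv => ⟨∅, Nat.zero_le _, fun E w hE _ hS => ?_⟩⟩
    change Sim p m Y X _ at hS
    by_contra hw
    have hw' : Y.Sat φ w ↔ (!b) = true := by cases b <;> simp_all
    have key : X.Sat φ v ↔ (!b) = true := by
      cases m with
      | zero => exact (hS.partialIso.swap.sat_iff hφ.zero_isQF hE).trans hw'
      | succ m =>
        obtain ⟨C, hC, h⟩ := hK p hp Y X w hw'
        obtain ⟨E', h1, h2, h3⟩ := hS C (hC.trans hp)
        exact h E' v (fun i => h1 _ _ (hE i)) h2 h3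
    cases b <;> simp_all

/-- `Π_{m+1}` sentences are preserved backwards along the game of `m + 1` rounds. -/
theorem exists_transfer {n m : ℕ} {χ : (sigmaLang n).Sentence} (hχ : IsPi (m + 1) χ) :
    ∃ k, ∀ X Y : Marked, Sim k (m + 1) X Y (noRel X Y) → Y.Sat χ default → X.Sat χ default := by
  obtain ⟨K, hK⟩ := exists_witnesses hχ
  refine ⟨K, fun X Y hS hY => ?_⟩
  by_contra hX
  obtain ⟨C, hC, h⟩ := hK K le_rfl X Y default
    ⟨fun h => (hX h).elim, fun h => (Bool.false_ne_true h).elim⟩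
  obtain ⟨E', _, h2, h3⟩ := hS C hC
  exact Bool.false_ne_true ((h E' default (fun i => i.elim0) h2 h3).1 hY)

end Marked

/-! ### The structures that are hard to tell apart -/

namespace Marked

variable {X Y Z : Marked} {l n : ℕ}

theorem emb_inl : Dat.Emb n X.dat (cat l X Y).dat Sum.inl :=
  ⟨Sum.inl_injective, fun _ _ => Iff.rfl, fun _ _ _ _ _ => Iff.rfl, fun _ _ _ _ _ => Iff.rfl,
    fun _ _ _ _ => Iff.rfl⟩

theorem emb_inr : Dat.Emb n Y.dat (cat l X Y).dat Sum.inr :=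
  ⟨Sum.inr_injective, fun _ _ => Iff.rfl, fun _ _ _ _ _ => Iff.rfl, fun _ _ _ _ _ => Iff.rfl,
    fun _ _ _ _ => Iff.rfl⟩

theorem emb_close : Dat.Emb l X.dat (close (l + 1) X).dat id :=
  ⟨Function.injective_id, fun _ _ => Iff.rfl, fun _ _ _ _ _ => Iff.rfl,
    fun i _ h _ _ => or_iff_left fun h' => by omega, fun _ _ _ _ => Iff.rfl⟩

theorem _root_.Dat.Emb.comp {A B C : Type} {d : Dat A} {e : Dat B} {c : Dat C} {f : A → B}
    {g : B → C} (hg : Dat.Emb n e c g) (hf : Dat.Emb n d e f) : Dat.Emb n d c (g ∘ f) :=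
  ⟨hg.inj.comp hf.inj, fun x y => (hg.le _ _).trans (hf.le x y),
    fun i h1 h2 x y => (hg.S i h1 h2 _ _).trans (hf.S i h1 h2 x y),
    fun i h1 h2 x y => (hg.R i h1 h2 _ _).trans (hf.R i h1 h2 x y),
    fun i h1 h2 x => (hg.pt i h1 h2 _).trans (hf.pt i h1 h2 x)⟩

theorem isLO_cat (hX : X.dat.IsLO) (hY : Y.dat.IsLO) : (cat l X Y).dat.IsLO where
  refl := by
    rintro (x | x)
    exacts [hX.refl x, hY.refl x]
  antisymm := by
    rintro (x | x) (y | y) h1 h2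
    exacts [congrArg _ (hX.antisymm _ _ h1 h2), h2.elim, h1.elim,
      congrArg _ (hY.antisymm _ _ h1 h2)]
  trans := by
    rintro (x | x) (y | y) (z | z) h1 h2
    exacts [hX.trans _ _ _ h1 h2, trivial, h2.elim, trivial, h1.elim, h1.elim, h2.elim,
      hY.trans _ _ _ h1 h2]
  total := by
    rintro (x | x) (y | y)
    exacts [hX.total x y, Or.inl trivial, Or.inr trivial, hY.total x y]

/-- The structure has no `PartialSucc_l` violation by `S_l`, its marks are at the ends of `P_l`, and
the symbols of the levels above `l`, as well as `R_l`, are not used. -/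
structure Pre (l : ℕ) (X : Marked) : Prop where
  isLO : X.dat.IsLO
  finite : Finite X
  S : ∀ x y, X.dat.S l x y → X.dat.lt x y ∧ ∀ z, X.dat.pt l z → X.dat.le z x ∨ X.dat.le y z
  top : ∀ x, X.top x → ∀ z, X.dat.pt l z → X.dat.le z x
  bot : ∀ x, X.bot x → ∀ z, X.dat.pt l z → X.dat.le x z
  transparent : X.transparent → ∀ z, ¬ X.dat.pt l z
  S_gt : ∀ i, l < i → ∀ x y, ¬ X.dat.S i x y
  R_ge : ∀ i, l ≤ i → ∀ x y, ¬ X.dat.R i x y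
  P_gt : ∀ i, l < i → ∀ x, ¬ X.dat.P i x

/-- The structure has no marks, and uses only symbols of the levels up to `l`. -/
structure Closed (l : ℕ) (X : Marked) : Prop where
  isLO : X.dat.IsLO
  finite : Finite X
  top : ∀ x, ¬ X.top x
  bot : ∀ x, ¬ X.bot x
  transparent : X.transparent
  S_gt : ∀ i, l < i → ∀ x y, ¬ X.dat.S i x y
  R_gt : ∀ i, l < i → ∀ x y, ¬ X.dat.R i x y
  P_gt : ∀ i, l < i → ∀ x, ¬ X.dat.P i x

theorem Pre.cat (hX : Pre l X) (hY : Pre l Y) : Pre l (cat l X Y) where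
  isLO := isLO_cat hX.isLO hY.isLO
  finite := by
    have := hX.finite
    have := hY.finite
    exact inferInstanceAs (Finite (X ⊕ Y))
  S := by
    rintro (x | x) (y | y) h
    · refine ⟨(emb_inl (n := 0).lt x y).2 (hX.S _ _ h).1, ?_⟩
      rintro (z | z) hz
      exacts [(hX.S _ _ h).2 z hz, Or.inr trivial]
    · refine ⟨⟨trivial, Sum.inl_ne_inr⟩, ?_⟩
      rintro (z | z) hz
      exacts [Or.inl (hX.top _ h.2.1 z hz), Or.inr (hY.bot _ h.2.2 z hz)]
    · exact h.elim
    · refine ⟨(emb_inr (n := 0).lt x y).2 (hY.S _ _ h).1, ?_⟩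
      rintro (z | z) hz
      exacts [Or.inl trivial, (hY.S _ _ h).2 z hz]
  top := by
    rintro (x | x) h (z | z) hz
    exacts [hX.top _ h.2 z hz, hY.transparent h.1 z hz, trivial, hY.top _ h z hz]
  bot := by
    rintro (x | x) h (z | z) hz
    exacts [hX.bot _ h z hz, trivial, hX.transparent h.1 z hz, hY.bot _ h.2 z hz]
  transparent := by
    rintro h (z | z) hz
    exacts [hX.transparent h.1 z hz, hY.transparent h.2 z hz]
  S_gt := by
    rintro i hi (x | x) (y | y) h
    exacts [hX.S_gt i hi _ _ h, hi.ne' h.1, h, hY.S_gt i hi _ _ h]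
  R_ge := by
    rintro i hi (x | x) (y | y) h
    exacts [hX.R_ge i hi _ _ h, h, h, hY.R_ge i hi _ _ h]
  P_gt := by
    rintro i hi (x | x) h
    exacts [hX.P_gt i hi _ h, hY.P_gt i hi _ h]

theorem Closed.cat (hX : Closed l X) (hY : Closed l Y) : Closed l (cat l X Y) where
  isLO := isLO_cat hX.isLO hY.isLO
  finite := by
    have := hX.finite
    have := hY.finite
    exact inferInstanceAs (Finite (X ⊕ Y))
  top := by
    rintro (x | x) h
    exacts [hX.top _ h.2, hY.top _ h]
  bot := by
    rintro (x | x) h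
    exacts [hX.bot _ h, hY.bot _ h.2]
  transparent := ⟨hX.transparent, hY.transparent⟩
  S_gt := by
    rintro i hi (x | x) (y | y) h
    exacts [hX.S_gt i hi _ _ h, hi.ne' h.1, h, hY.S_gt i hi _ _ h]
  R_gt := by
    rintro i hi (x | x) (y | y) h
    exacts [hX.R_gt i hi _ _ h, h, h, hY.R_gt i hi _ _ h]
  P_gt := by
    rintro i hi (x | x) h
    exacts [hX.P_gt i hi _ h, hY.P_gt i hi _ h]

theorem Pre.close (h : Pre l X) : Closed l (close l X) where
  isLO := ⟨h.isLO.refl, h.isLO.antisymm, h.isLO.trans, h.isLO.total⟩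
  finite := h.finite
  top _ h := h
  bot _ h := h
  transparent := trivial
  S_gt := h.S_gt
  R_gt i hi x y h' := h'.elim (h.R_ge i hi.le x y) fun h' => hi.ne' h'.1
  P_gt := h.P_gt

theorem Closed.pre (h : Closed l X) (hl : 1 ≤ l) : Pre (l + 1) X where
  isLO := h.isLO
  finite := h.finite
  S x y h' := (h.S_gt _ l.lt_succ_self x y h').elim
  top x h' := (h.top x h').elim
  bot x h' := (h.bot x h').elim
  transparent _ z hz := h.P_gt _ l.lt_succ_self z (hz.resolve_left (by omega))
  S_gt i hi := h.S_gt i (by omega)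
  R_ge i hi := h.R_gt i (by omega)
  P_gt i hi := h.P_gt i (by omega)

theorem pre_unit : Pre l unit where
  isLO := ⟨fun x => x.elim, fun x => x.elim, fun x => x.elim, fun x => x.elim⟩
  finite := inferInstanceAs (Finite Empty)
  S x := x.elim
  top x := x.elim
  bot x := x.elim
  transparent _ x := x.elim
  S_gt _ _ x := x.elim
  R_ge _ _ x := x.elim
  P_gt _ _ x := x.elim

theorem closed_unit : Closed l unit where
  isLO := pre_unit (l := 0).isLO
  finite := pre_unit (l := 0).finite
  top x := x.elim
  bot x := x.elim
  transparent := trivial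
  S_gt _ _ x := x.elim
  R_gt _ _ x := x.elim
  P_gt _ _ x := x.elim

theorem Pre.pow (h : Pre l X) (a : ℕ) : Pre l (pow l X a) := by
  induction a with
  | zero => exact pre_unit
  | succ a ih => exact h.cat ih

theorem Closed.pow (h : Closed l X) (a : ℕ) : Closed l (pow l X a) := by
  induction a with
  | zero => exact closed_unit
  | succ a ih => exact h.cat ih

/-- A single element of `P_l`, which carries both marks. -/
def point (l : ℕ) : Marked where
  carrier := Unit
  dat := ⟨fun _ _ => True, fun _ _ _ => False, fun _ _ _ => False, fun i _ => i = l⟩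
  bot _ := True
  top _ := True
  transparent := False

theorem pre_point : Pre l (point l) where
  isLO := ⟨fun _ => trivial, fun _ _ _ _ => rfl, fun _ _ _ _ _ => trivial, fun _ _ => Or.inl trivial⟩
  finite := inferInstanceAs (Finite Unit)
  S _ _ h := h.elim
  top _ _ _ _ := trivial
  bot _ _ _ _ := trivial
  transparent h := h.elim
  S_gt _ _ _ _ h := h
  R_ge _ _ _ _ h := h
  P_gt _ hi _ h := hi.ne' h

theorem pt_point : (point l).dat.pt l () := Or.inr rfl

/-- The empty structure that separates the marks of its neighbours. -/
def gap : Marked := { unit with transparent := False }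

theorem pre_gap : Pre l gap :=
  { pre_unit (l := l) with transparent := fun _ x => x.elim }

/-! #### Structures that satisfy `SomeTotalR_{l+1}` -/

/-- A step of the paths of level `l + 1`. -/
def Step (l : ℕ) (X : Marked) (u v : X) : Prop :=
  X.dat.succRel (l + 1) (X.dat.SomeTotal X.dat.path l) u v ∧ X.dat.lt u v

theorem Step.map {f : X → Y} (h : Dat.Emb l X.dat Y.dat f)
    (hpt : ∀ x, X.dat.pt (l + 1) x → Y.dat.pt (l + 1) (f x))
    (hS : ∀ x y, X.dat.S (l + 1) x y → Y.dat.S (l + 1) (f x) (f y)) {u v : X}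
    (huv : Step l X u v) : Step l Y (f u) (f v) :=
  ⟨⟨hpt _ huv.1.1, hpt _ huv.1.2.1, hS _ _ huv.1.2.2.1, (h.le _ _).2 huv.1.2.2.2.1,
    h.map_path le_rfl (fun _ hz => ⟨(h.le _ _).2 hz.1, (h.le _ _).2 hz.2⟩) huv.1.2.2.2.2⟩,
    (h.lt _ _).2 huv.2⟩

theorem Step.inl {u v : X} (h : Step l X u v) : Step l (cat (l + 1) X Y) (.inl u) (.inl v) :=
  h.map emb_inl (fun _ h => h) fun _ _ h => h

theorem Step.inr {u v : Y} (h : Step l Y u v) : Step l (cat (l + 1) X Y) (.inr u) (.inr v) :=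
  h.map emb_inr (fun _ h => h) fun _ _ h => h

/-- A path of level `l + 1` leads from a `bot` element to a `top` element, and it can be continued
into whatever comes next, since `SomeTotalR_l` holds above its end. -/
def Chain (l : ℕ) (X : Marked) : Prop :=
  ∃ x y, X.bot x ∧ X.top y ∧ X.dat.pt (l + 1) x ∧ X.dat.pt (l + 1) y ∧
    Relation.ReflTransGen (Step l X) x y ∧ X.dat.SomeTotal X.dat.path l {z | X.dat.le y z}

theorem step_cat {x : X} {y : Y} (hx : X.dat.pt (l + 1) x) (hy : Y.dat.pt (l + 1) y)
    (htop : X.top x) (hbot : Y.bot y) (hT : X.dat.SomeTotal X.dat.path l {z | X.dat.le x z}) :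
    Step l (cat (l + 1) X Y) (.inl x) (.inr y) :=
  ⟨⟨hx, hy, ⟨rfl, htop, hbot⟩, trivial,
    (emb_inl (n := l)).map_path le_rfl (fun _ hz => ⟨hz, trivial⟩) hT⟩, trivial, Sum.inl_ne_inr⟩

theorem Chain.cat (hX : Chain l X) (hY : Chain l Y) : Chain l (cat (l + 1) X Y) := by
  obtain ⟨x, x', h1, h2, h3, h4, h5, h6⟩ := hX
  obtain ⟨y, y', h1', h2', h3', h4', h5', h6'⟩ := hY
  refine ⟨.inl x, .inr y', h1, h2', h3, h4', ?_, ?_⟩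
  · exact (h5.lift Sum.inl fun _ _ h => h.inl).trans
      ((h5'.lift Sum.inr fun _ _ h => h.inr).head (step_cat h4 h3' h2 h1' h6))
  · exact (emb_inr (n := l)).map_path le_rfl (fun _ hz => hz) h6'

theorem Chain.cat_transparent (hX : Chain l X) (hY : Y.transparent) :
    Chain l (Marked.cat (l + 1) X Y) := by
  obtain ⟨x, x', h1, h2, h3, h4, h5, h6⟩ := hX
  exact ⟨.inl x, .inl x', h1, ⟨hY, h2⟩, h3, h4, h5.lift Sum.inl fun _ _ h => h.inl,
    (emb_inl (n := l)).map_path le_rfl (fun _ hz => hz) h6⟩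

theorem Chain.pow (hX : Chain l X) (a : ℕ) : Chain l (pow (l + 1) X (a + 1)) := by
  induction a with
  | zero => exact hX.cat_transparent trivial
  | succ a ih => exact hX.cat ih

/-- A chain, completed by a last point and closed, satisfies `SomeTotalR_{l+1}`. -/
theorem Chain.someTotal_close (hX : Chain l X) :
    (close (l + 1) (Marked.cat (l + 1) X (point (l + 1)))).dat.SomeTotal
      (close (l + 1) (Marked.cat (l + 1) X (point (l + 1)))).dat.path (l + 1) Set.univ := by
  obtain ⟨x, x', h1, h2, h3, h4, h5, h6⟩ := hX
  refine Or.inr (Or.inr ⟨.inl x, trivial, .inr (), trivial, Or.inr ⟨rfl, h1, trivial⟩, ?_⟩)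
  have h : Relation.TransGen (Step l (Marked.cat (l + 1) X (point (l + 1)))) (.inl x) (.inr ()) :=
    Relation.TransGen.tail' (h5.lift Sum.inl fun _ _ h => h.inl)
      (step_cat h4 pt_point h2 trivial h6)
  exact h.lift (p := Step l (close (l + 1) _)) id
    (fun _ _ h => h.map emb_close (fun _ h => h) fun _ _ h => h) _ _

theorem chain_point_cat_point : Chain 0 (Marked.cat 1 (point 1) (point 1)) :=
  ⟨.inl (), .inr (), trivial, trivial, Or.inl rfl, Or.inl rfl,
    .single (step_cat (Or.inl rfl) (Or.inl rfl) trivial trivial trivial), trivial⟩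

theorem chain_point_cat (hA : Closed l X)
    (hT : X.dat.SomeTotal X.dat.path l Set.univ) :
    Chain l (Marked.cat (l + 1) (point (l + 1)) X) :=
  ⟨.inl (), .inl (), trivial, ⟨hA.transparent, trivial⟩, pt_point, pt_point, .refl,
    (emb_inr (n := l)).map_path le_rfl (fun _ _ => trivial) hT⟩

/-! #### Structures that do not satisfy `SomeTotalR_{l+1}` -/

/-- Without marks, a concatenation satisfies `SomeTotalR_l` only if one of the factors does. -/
theorem Closed.someTotal_of_cat {i : ℕ} (hX : Closed l X) (hY : Closed l Y)
    (hT : (Marked.cat l X Y).dat.SomeTotal (Marked.cat l X Y).dat.path (i + 1) Set.univ) :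
    X.dat.SomeTotal X.dat.path (i + 1) Set.univ ∨ Y.dat.SomeTotal Y.dat.path (i + 1) Set.univ := by
  have hLO : (Marked.cat l X Y).dat.IsLO := (hX.cat hY).isLO
  have hconvl : ∀ (x y : X) z, (Marked.cat l X Y).dat.le (.inl x) z →
      (Marked.cat l X Y).dat.le z (.inl y) → z ∈ Set.range (Sum.inl : X → X ⊕ Y) := by
    rintro x y (z | z) h1 h2
    exacts [⟨z, rfl⟩, h2.elim]
  have hconvr : ∀ (x y : Y) z, (Marked.cat l X Y).dat.le (.inr x) z →
      (Marked.cat l X Y).dat.le z (.inr y) → z ∈ Set.range (Sum.inr : Y → X ⊕ Y) := by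
    rintro x y (z | z) h1 h2
    exacts [h1.elim, ⟨z, rfl⟩]
  have keyl : ∀ x y : X, (Marked.cat l X Y).dat.SomeTotal (Marked.cat l X Y).dat.path (i + 1)
      ((Marked.cat l X Y).dat.Icc (.inl x) (.inl y)) →
      X.dat.SomeTotal X.dat.path (i + 1) Set.univ := fun x y h =>
    (emb_inl.reflect_path hLO le_rfl hconvl (fun _ hu _ hv => hLO.Icc_subset hu hv)
      (fun _ _ _ u hu v hv _ => ⟨hconvl x y u hu.1 hu.2, hconvl x y v hv.1 hv.2⟩) h).mono _
      (Set.subset_univ _)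
  have keyr : ∀ x y : Y, (Marked.cat l X Y).dat.SomeTotal (Marked.cat l X Y).dat.path (i + 1)
      ((Marked.cat l X Y).dat.Icc (.inr x) (.inr y)) →
      Y.dat.SomeTotal Y.dat.path (i + 1) Set.univ := fun x y h =>
    (emb_inr.reflect_path hLO le_rfl hconvr (fun _ hu _ hv => hLO.Icc_subset hu hv)
      (fun _ _ _ u hu v hv _ => ⟨hconvr x y u hu.1 hu.2, hconvr x y v hv.1 hv.2⟩) h).mono _
      (Set.subset_univ _)
  -- The related pair that witnesses `hT` lies in one of the factors, and so does its interval.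
  have hIcc : ∀ x y, (Marked.cat l X Y).dat.S (i + 1) x y ∨ (Marked.cat l X Y).dat.R (i + 1) x y →
      (Marked.cat l X Y).dat.SomeTotal (Marked.cat l X Y).dat.path (i + 1)
        ((Marked.cat l X Y).dat.Icc x y) →
      X.dat.SomeTotal X.dat.path (i + 1) Set.univ ∨
        Y.dat.SomeTotal Y.dat.path (i + 1) Set.univ := by
    rintro (x | x) (y | y) h1 h2
    · exact Or.inl (keyl x y h2)
    · exact (h1.elim (fun h => hX.top _ h.2.1) fun h => h.elim).elim
    · exact (h1.elim (fun h => h) fun h => h).elim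
    · exact Or.inr (keyr x y h2)
  rcases hT with ⟨rfl, x, -, y, -, h1, h2⟩ | ⟨x, -, y, -, h1, z, -, h2, h3, h4⟩ |
    ⟨x, -, y, -, h1, h2⟩
  · rcases x with x | x <;> rcases y with y | y
    · exact Or.inl (Or.inl ⟨rfl, x, trivial, y, trivial, h1,
        fun h => h2 ((emb_inl (n := 0).lt x y).2 h)⟩)
    · exact (hX.top _ h1.2.1).elim
    · exact h1.elim
    · exact Or.inr (Or.inl ⟨rfl, x, trivial, y, trivial, h1,
        fun h => h2 ((emb_inr (n := 0).lt x y).2 h)⟩)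
  · have hxy := h1.2.2.2.1
    exact hIcc x y (Or.inl h1.2.2.1) (Or.inr (Or.inl ⟨x, ⟨hLO.refl _, hxy⟩, y,
      ⟨hxy, hLO.refl _⟩, h1, z, ⟨(hLO.not_le.1 h3).1, (hLO.not_le.1 h4).1⟩, h2, h3, h4⟩))
  · have hxy := (hLO.lt_of_path (i := i + 1) h2).1
    exact hIcc x y (Or.inr h1) (Or.inr (Or.inr ⟨x, ⟨hLO.refl _, hxy⟩, y,
      ⟨hxy, hLO.refl _⟩, h1, h2⟩))

theorem Closed.not_someTotal_pow {i : ℕ} (hX : Closed l X)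
    (hT : ¬ X.dat.SomeTotal X.dat.path (i + 1) Set.univ) (a : ℕ) :
    ¬ (Marked.pow l X a).dat.SomeTotal (Marked.pow l X a).dat.path (i + 1) Set.univ := by
  induction a with
  | zero =>
    rintro (⟨_, x, _⟩ | ⟨x, _⟩ | ⟨x, _⟩) <;> exact x.elim
  | succ a ih => exact fun h => (hX.someTotal_of_cat (hX.pow a) h).elim hT ih

theorem _root_.Relation.TransGen.exists_crossing {α : Type} {r : α → α → Prop} {p : α → Prop}
    {x y : α} (h : Relation.TransGen r x y) (hx : p x) (hy : ¬ p y) :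
    ∃ u v, r u v ∧ p u ∧ ¬ p v := by
  induction h with
  | single h => exact ⟨_, _, h, hx, hy⟩
  | @tail u v _ h ih =>
    by_cases hu : p u
    · exact ⟨_, _, h, hu, hy⟩
    · exact ih hu

/-- A power of the factor `point · A`, in the middle of which one factor is `point · B`. -/
def interrupted (l : ℕ) (A B : Marked) (a : ℕ) : Marked :=
  cat l (cat l (pow l (cat l (point l) A) a)
    (cat l (cat l (point l) B) (pow l (cat l (point l) A) a))) (point l)

theorem pre_interrupted {A B : Marked} (hA : Pre l A) (hB : Pre l B) (a : ℕ) :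
    Pre l (interrupted l A B a) :=
  (((pre_point.cat hA).pow a).cat ((pre_point.cat hB).cat ((pre_point.cat hA).pow a))).cat
    pre_point

/-- The elements before the second power in `interrupted l A B a`. -/
def beforeGap (l : ℕ) (A B : Marked) (a : ℕ) : interrupted l A B a → Prop
  | .inl (.inl _) => True
  | .inl (.inr (.inl _)) => True
  | _ => False

/-- The first element of `point · B`. -/
def gapStart (l : ℕ) (A B : Marked) (a : ℕ) : interrupted l A B a := .inl (.inr (.inl (.inl ())))

/-- The first element after `point · B`. -/
def gapEnd (l : ℕ) (A B : Marked) (a : ℕ) : interrupted l A B (a + 1) :=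
  .inl (.inr (.inr (.inl (.inl ()))))

/-- The inclusion of the copy of `B`. -/
def gapInclusion (l : ℕ) (A B : Marked) (a : ℕ) (x : B) : interrupted l A B a :=
  .inl (.inr (.inl (.inr x)))

/-- Only one pair of `S_l` could cross the gap, and only if `B` is transparent. -/
theorem eq_of_S_interrupted {A B : Marked} {a : ℕ} (htop : ∀ x, ¬ B.top x)
    {u v : interrupted l A B (a + 1)} (hS : (interrupted l A B (a + 1)).dat.S l u v)
    (hu : beforeGap l A B (a + 1) u) (hv : ¬ beforeGap l A B (a + 1) v) :
    B.transparent ∧ u = gapStart l A B (a + 1) ∧ v = gapEnd l A B a := by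
  rcases u with (u | (⟨⟩ | u) | u) | u
  · rcases v with (v | v | v) | v
    · exact (hv trivial).elim
    · exact (hv trivial).elim
    · exact hS.2.2.1.1.elim
    · exact hS.2.1.1.1.1.elim
  · rcases v with (v | v | (⟨⟩ | v) | v) | v
    · exact (hv trivial).elim
    · exact (hv trivial).elim
    · exact ⟨hS.2.1.1, rfl, rfl⟩
    · exact hS.2.2.1.elim
    · exact hS.2.2.1.1.elim
    · exact hS.2.1.1.1.1.elim
  · rcases v with (v | v | v) | v
    · exact (hv trivial).elim
    · exact (hv trivial).elim
    · exact (htop _ hS.2.1).elim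
    · exact (htop _ hS.2.1.2).elim
  · exact hu.elim
  · exact hu.elim

theorem eq_of_mem_Icc_gap {A B : Marked} {a : ℕ} {z : interrupted l A B (a + 1)}
    (h1 : (interrupted l A B (a + 1)).dat.le (gapStart l A B (a + 1)) z)
    (h2 : (interrupted l A B (a + 1)).dat.le z (gapEnd l A B a)) :
    z = gapStart l A B (a + 1) ∨ z = gapEnd l A B a ∨
      z ∈ Set.range (gapInclusion l A B (a + 1)) := by
  rcases z with (z | (⟨⟩ | z) | (⟨⟩ | z) | z) | z
  exacts [h1.elim, Or.inl rfl, Or.inr (Or.inr ⟨z, rfl⟩), Or.inr (Or.inl rfl), h2.elim, h2.elim,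
    h2.elim]

/-- An interrupted power does not satisfy `SomeTotalR_{l+1}`, because a path of level `l + 1` would
have to step over the copy of `B`. -/
theorem not_someTotal_close_interrupted {A B : Marked} (hA : Pre (l + 1) A) (hB : Pre (l + 1) B)
    (htop : ∀ x, ¬ B.top x) (hT : B.transparent → ¬ B.dat.SomeTotal B.dat.path l Set.univ)
    (a : ℕ) : ¬ (close (l + 1) (interrupted (l + 1) A B (a + 1))).dat.SomeTotal
      (close (l + 1) (interrupted (l + 1) A B (a + 1))).dat.path (l + 1) Set.univ := by
  have hpre := pre_interrupted hA hB (a + 1)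
  have hLO : (close (l + 1) (interrupted (l + 1) A B (a + 1))).dat.IsLO := hpre.close.isLO
  rintro (⟨rfl, x, -, y, -, h1, h2⟩ | ⟨x, -, y, -, h1, z, -, h2, h3, h4⟩ | ⟨x, -, y, -, h1, h2⟩)
  · exact h2 (hpre.S x y h1).1
  · exact ((hpre.S x y h1.2.2.1).2 z h2).elim h3 h4
  · obtain ⟨-, hx, hy⟩ := h1.resolve_left (hpre.R_ge _ le_rfl x y)
    have hx' : beforeGap (l + 1) A B (a + 1) x := by
      rcases x with (x | x | x) | x
      exacts [trivial, trivial, hx.1.1.1.elim, hx.1.1.1.1.elim]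
    have hy' : ¬ beforeGap (l + 1) A B (a + 1) y := by
      rcases y with (y | y | y) | y
      exacts [hy.1.elim, hy.1.elim, id, id]
    obtain ⟨u, v, ⟨hs, -⟩, hu, hv⟩ := h2.exists_crossing hx' hy'
    obtain ⟨htr, rfl, rfl⟩ := eq_of_S_interrupted htop hs.2.2.1 hu hv
    have hemb : Dat.Emb l B.dat (close (l + 1) (interrupted (l + 1) A B (a + 1))).dat
        (gapInclusion (l + 1) A B (a + 1)) :=
      emb_close.comp (emb_inl.comp (emb_inr.comp (emb_inl.comp emb_inr)))
    refine hT htr ((hemb.reflect_path hLO le_rfl ?_ (fun _ hu _ hv => hLO.Icc_subset hu hv) ?_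
      hs.2.2.2.2).mono _ (Set.subset_univ _))
    · rintro x y ((z | (⟨⟩ | z) | z) | z) h1 h2
      exacts [h1.elim, h1.elim, ⟨z, rfl⟩, h2.elim, h2.elim]
    · intro i _ hi x hx y hy hR
      -- The ends of the gap are not related to anything in it at the lower levels.
      rcases eq_of_mem_Icc_gap hx.1 hx.2 with rfl | rfl | ⟨x, rfl⟩ <;>
        rcases eq_of_mem_Icc_gap hy.1 hy.2 with rfl | rfl | ⟨y, rfl⟩
      on_goal 9 => exact ⟨⟨x, rfl⟩, ⟨y, rfl⟩⟩
      all_goals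
        rcases hR with h | h | h
        · first
          | exact False.elim h
          | exact absurd (show i = l + 1 from And.left h) (by omega)
        · exact False.elim h
        · exact absurd h.1 (by omega)

/-! #### The induction on the level -/

/-- `A` and `B`, seen from level `l + 1`: the copies of `A` can be linked to a chain, those of `B`
interrupt a chain, and Duplicator can pass off `A` as `B` for `2 l + 1` rounds. -/
structure LevelPair (k l : ℕ) (A B : Marked) : Prop where
  preA : Pre (l + 1) A
  preB : Pre (l + 1) B
  chain : Chain l (Marked.cat (l + 1) (point (l + 1)) A)
  top : ∀ x, ¬ B.top x
  not_someTotal : B.transparent → ¬ B.dat.SomeTotal B.dat.path l Set.univ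
  sim : Sim k (2 * l + 1) B A (noRel B A)

theorem levelPair_zero (k : ℕ) : LevelPair k 0 (point 1) gap where
  preA := pre_point
  preB := pre_gap
  chain := chain_point_cat_point
  top x := x.elim
  not_someTotal h := h.elim
  sim _ _ := ⟨noRel _ _, fun _ _ h => h, fun x => x.elim,
    ⟨Iff.rfl, fun h => h.elim, fun h => h.elim, fun _ _ _ _ _ h => h.elim,
      fun _ _ _ _ _ h => h.elim, fun _ _ _ h => h.elim, fun h => h.elim, fun h => h.elim⟩⟩

/-- `A` satisfies `SomeTotalR_l` and `B` does not, but Duplicator can pass off `A` as `B` for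
`2 l + 1` rounds. -/
structure FinalPair (k l : ℕ) (A B : Marked) : Prop where
  closedA : Closed l A
  closedB : Closed l B
  nonempty : Nonempty B
  someTotal : A.dat.SomeTotal A.dat.path l Set.univ
  not_someTotal : ¬ B.dat.SomeTotal B.dat.path l Set.univ
  sim : Sim k (2 * l + 1) B A (noRel B A)

theorem FinalPair.levelPair {k l : ℕ} {A B : Marked} (h : FinalPair k l A B) (hl : 1 ≤ l) :
    LevelPair k l A B where
  preA := h.closedA.pre hl
  preB := h.closedB.pre hl
  chain := chain_point_cat h.closedA h.someTotal
  top := h.closedB.top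
  not_someTotal _ := h.not_someTotal
  sim := h.sim

/-- The step from one level to the next. With `Y = point · A` and `X = point · B`, an interval with
a total `R_{l+1}` is made from a power of `Y`, and one without from a power of `Y` interrupted by
`X`; the new `B` is a power of intervals of the second kind, and the new `A` has in addition
one interval of the first kind. Each of the two insertions costs Spoiler one more round. -/
theorem LevelPair.exists_finalPair {k l : ℕ} {A B : Marked} (h : LevelPair k l A B) :
    ∃ A' B', FinalPair k (l + 1) A' B' := by
  have hXY : Sim k (2 * l + 1) (Marked.cat (l + 1) (point (l + 1)) B)
      (Marked.cat (l + 1) (point (l + 1)) A) (noRel _ _) := (Isom.refl _).sim.cat_noRel h.sim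
  obtain ⟨N, hN⟩ := exists_round_insert (l + 1) hXY
  have hI := ((hN (N + 1) (Nat.le_succ N)).cat_noRel (l := l + 1)
    (Isom.refl (point (l + 1))).sim).close (l := l + 1)
  obtain ⟨N', hN'⟩ := exists_round_insert (l + 1) hI
  have hY := pre_point.cat h.preA
  have hIt : Closed (l + 1) (close (l + 1) (Marked.cat (l + 1)
      (Marked.pow (l + 1) (Marked.cat (l + 1) (point (l + 1)) A) (N + 1)) (point (l + 1)))) :=
    ((hY.pow _).cat pre_point).close
  have hIg := (pre_interrupted h.preA h.preB (N + 1)).close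
  refine ⟨_, _, (hIg.pow (N' + 1)).cat (hIt.cat (hIg.pow (N' + 1))), hIg.pow (N' + 1), ?_, ?_, ?_,
    hN' (N' + 1) (Nat.le_succ N')⟩
  · exact ⟨.inl (.inr ())⟩
  · exact (emb_inr.comp emb_inl).map_path le_rfl (fun _ _ => trivial)
      (h.chain.pow N).someTotal_close
  · exact hIg.not_someTotal_pow
      (not_someTotal_close_interrupted h.preA h.preB h.top h.not_someTotal N) _

theorem exists_finalPair (k l : ℕ) : ∃ A B, FinalPair k (l + 1) A B := by
  induction l with
  | zero => exact (levelPair_zero k).exists_finalPair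
  | succ l ih =>
    obtain ⟨A, B, h⟩ := ih
    exact (h.levelPair (by omega)).exists_finalPair

end Marked

/-! ### The sentence `NLO ∨ SomeTotalR_n` -/

theorem exists_isSigma_someTotal (n : ℕ) : ∃ φ : (sigmaLang n).Sentence, IsSigma (2 * n + 1) φ ∧
    ∀ (A : Type) [(sigmaLang n).Structure A] [Nonempty A], A ⊨ φ ↔
      ¬ (datOf n A).IsLO ∨ (datOf n A).SomeTotal (datOf n A).total n Set.univ := by
  obtain ⟨φ, h1, h2⟩ := (prefixDefinable_not_isLO (n := n) (k := 0)).mono_le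
    (m' := 2 * n + 1) (by omega) |>.or
    (prefixDefinable_someTotal n (fun _ _ _ => Set.univ) fun _ _ =>
      (prefixDefinable_const True))
  exact ⟨φ, h1, fun A _ _ => h2 A default⟩

theorem emb_datOf {n : ℕ} {A B : Type} [(sigmaLang n).Structure A] [(sigmaLang n).Structure B]
    (f : A ↪[sigmaLang n] B) : Dat.Emb n (datOf n A) (datOf n B) f := by
  have h2 : ∀ (r : (sigmaLang n).Relations 2) (x y : A),
      Structure.RelMap r ![f x, f y] ↔ Structure.RelMap r ![x, y] := by
    intro r x y
    rw [← f.map_rel r, comp_pair]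
  have h1 : ∀ (r : (sigmaLang n).Relations 1) (x : A),
      Structure.RelMap r ![f x] ↔ Structure.RelMap r ![x] := by
    intro r x
    rw [← f.map_rel r, comp_single]
  exact ⟨f.injective, h2 _, fun _ _ _ _ _ => exists_congr fun _ => h2 _ _ _,
    fun _ _ _ _ _ => exists_congr fun _ => h2 _ _ _,
    fun _ _ _ _ => or_congr_right (exists_congr fun _ => h1 _ _)⟩

/-- In the range of levels of `σ_n`, nothing is lost by passing to the structure for `σ_n`. -/
theorem Marked.emb_toStructure (n : ℕ) (X : Marked) :
    letI := X.toStructure n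
    Dat.Emb n X.dat (datOf n X) id ∧ Dat.Emb n (datOf n X) X.dat id := by
  let := X.toStructure n
  have h : Dat.Emb n X.dat (datOf n X) id := by
    refine ⟨Function.injective_id, fun _ _ => Iff.rfl, fun i h1 h2 _ _ => ?_,
      fun i h1 h2 _ _ => ?_, fun i h1 h2 x => ?_⟩
    · exact ⟨fun h => h.2, fun h => ⟨⟨h1, h2⟩, h⟩⟩
    · exact ⟨fun h => h.2, fun h => ⟨⟨h1, h2⟩, h⟩⟩
    · refine or_congr_right' fun hi => ?_
      have h3 : 2 ≤ i := by omega
      exact ⟨fun h => h.2, fun h => ⟨⟨h3, h2⟩, h⟩⟩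
  exact ⟨h, h.inj, fun x y => (h.le x y).symm, fun i h1 h2 x y => (h.S i h1 h2 x y).symm,
    fun i h1 h2 x y => (h.R i h1 h2 x y).symm, fun i h1 h2 x => (h.pt i h1 h2 x).symm⟩

/-- The first part of the theorem, for one `n`: the sentence is `NLO ∨ SomeTotalR_n` in prenex form. -/
theorem exists_separating_sentence (n : ℕ) (hn : 1 ≤ n) : ∃ φ : (sigmaLang n).Sentence,
      IsSigma (2 * n + 1) φ ∧
      (φ ⇔[(∅ : (sigmaLang n).Theory)] (NLO n ⊔ someTotalR n hn)) ∧
      ExtensionClosed φ ∧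
      DatalogDefinable φ ∧
      ETCDefinable φ ∧
      ¬ ∃ χ : (sigmaLang n).Sentence, IsPi (2 * n + 1) χ ∧ FinEquiv φ χ := by
  obtain ⟨φ, hsig, hφ⟩ := exists_isSigma_someTotal n
  have hfin : ∀ (A : Type) [(sigmaLang n).Structure A] [Nonempty A] [Finite A], A ⊨ φ ↔
      ¬ (datOf n A).IsLO ∨ (datOf n A).SomeTotal (datOf n A).path n Set.univ := by
    intro A _ _ _
    rw [hφ]
    by_cases hLO : (datOf n A).IsLO
    · rw [hLO.someTotal_iff n _ fun _ _ _ _ => Set.subset_univ _]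
    · simp [hLO]
  refine ⟨φ, hsig, ?_, ?_, ?_, ?_, ?_⟩
  · intro M v xs
    have h1 : (M : Type) ⊨ NLO n ⊔ someTotalR n hn ↔ _ := BoundedFormula.realize_sup
    rw [BoundedFormula.realize_iff, Subsingleton.elim v default, Subsingleton.elim xs default]
    refine (hφ M).trans (Iff.symm (h1.trans ?_))
    change (M : Type) ⊨ NLO n ∨ (M : Type) ⊨ someTotalR n hn ↔ _
    rw [realize_NLO]
    by_cases hLO : (datOf n M).IsLO
    · rw [someTotalR, realize_someTotalRAux n hn le_rfl hLO]
    · simp [hLO]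
  · intro A B _ _ _ _ _ f hA
    have : Nonempty B := ‹Nonempty A›.map f
    rw [hfin] at hA ⊢
    by_cases hLO : (datOf n B).IsLO
    · have hT := hA.resolve_left (not_not.2 (hLO.of_emb (emb_datOf f)))
      exact Or.inr ((emb_datOf f).map_path le_rfl (fun _ _ => trivial) hT)
    · exact Or.inl hLO
  · exact ⟨SomeTotalIdb.program n, fun A _ _ _ => (hfin A).trans SomeTotalIdb.accepts_iff.symm⟩
  · exact ⟨_, fun A _ _ _ => (hfin A).trans ETCFormula.realize_notLinear_or.symm⟩
  · rintro ⟨χ, hχ, heq⟩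
    obtain ⟨k, hk⟩ := Marked.exists_transfer hχ
    obtain ⟨l, rfl⟩ : ∃ l, n = l + 1 := ⟨n - 1, by omega⟩
    obtain ⟨A, B, h⟩ := Marked.exists_finalPair k l
    let := A.toStructure (l + 1)
    let := B.toStructure (l + 1)
    have := h.closedA.finite
    have := h.closedB.finite
    have hA := A.emb_toStructure (l + 1)
    have hB := B.emb_toStructure (l + 1)
    have : Nonempty B := h.nonempty
    have : Nonempty A := by
      rcases h.someTotal with ⟨-, x, -⟩ | ⟨x, -⟩ | ⟨x, -⟩ <;> exact ⟨x⟩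
    have hAφ : A ⊨ φ := (hfin A).2
      (Or.inr (hA.1.map_path le_rfl (fun _ _ => trivial) h.someTotal))
    have hBφ : B ⊨ φ := (heq B).2 (hk B A h.sim ((heq A).1 hAφ))
    rcases (hfin B).1 hBφ with hB' | hB'
    · exact hB' (h.closedB.isLO.of_emb hB.2)
    · exact h.not_someTotal (hB.2.map_path le_rfl (fun _ _ => trivial) hB')

theorem theorem1 :
    (∀ (n : ℕ) (hn : 1 ≤ n), ∃ φ : (sigmaLang n).Sentence,
      IsSigma (2 * n + 1) φ ∧
      (φ ⇔[(∅ : (sigmaLang n).Theory)] (NLO n ⊔ someTotalR n hn)) ∧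
      ExtensionClosed φ ∧
      DatalogDefinable φ ∧
      ETCDefinable φ ∧
      ¬ ∃ χ : (sigmaLang n).Sentence, IsPi (2 * n + 1) χ ∧ FinEquiv φ χ) ∧
    (∀ m : ℕ, ∃ (n : ℕ) (φ : (sigmaLang n).Sentence), 1 ≤ n ∧
      ExtensionClosed φ ∧
      DatalogDefinable φ ∧
      ETCDefinable φ ∧
      ¬ ∃ χ : (sigmaLang n).Sentence, (IsSigma m χ ∨ IsPi m χ) ∧ FinEquiv φ χ) := by
  refine ⟨exists_separating_sentence, fun m => ?_⟩
  obtain ⟨φ, -, -, h1, h2, h3, h4⟩ := exists_separating_sentence (m + 1) (by omega)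
  refine ⟨m + 1, φ, by omega, h1, h2, h3, fun ⟨χ, hχ, heq⟩ => h4 ⟨χ, ?_, heq⟩⟩
  rcases hχ with hχ | hχ
  · exact PrefixClass.mono_le (PrefixClass.alternate (b := false) hχ) (by omega)
  · exact PrefixClass.mono_le hχ (by omega)
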